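/- All rings are commutative and noetherian, and all modules are finitely generated. Let $R$ be a Cohen–Macaulay local ring of Krull dimension $d$ with residue field $k$ and maximal ideal $\mathfrak m$. A module $M$ is said to be free on the punctured spectrum of $R$ if $M_{\mathfrak p}$ is a free $R_{\mathfrak p}$-module for every prime ideal $\mathfrak p\neq\mathfrak m$. Write $\Omega^i k$ for the $i$-th syzygy of $k$ in a minimal free resolution (with $\Omega^0k=k$). For an $R$-module $X$, let $\operatorname{ext}(X)$ be the extension closure of $X$, i.e. the smallest full subcategory, closed under isomorphism, of the category of finitely generated $R$-modules that contains $X$ and is closed under direct summands and extensions. Let $\mathrm{CM}(R)$ be the full subcategory of (maximal) Cohen–Macaulay modules, that is, the zero module and the modules of depth $d$. Then: 1. If $M$ is an $R$-module of depth $t$ (with $t$ a nonnegative integer, so $M\neq 0$) that is free on the punctured spectrum of $R$, then $M\in\operatorname{ext}\bigl(\bigoplus_{i=t}^{d}\Omega^i k\bigr)$. 2. Every $M\in\mathrm{CM}(R)$ that is free on the punctured spectrum of $R$ belongs to $\operatorname{ext}(\Omega^d k)$. 3. If $R$ has an isolated singularity, i.e. $R_{\mathfrak p}$ is a regular local ring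 for every prime ideal $\mathfrak p\ne\mathfrak m$, then $\mathrm{CM}(R)=\operatorname{ext}(\Omega^d k)$. -/

import Mathlib

open IsLocalRing
open scoped DirectSum

universe u

section Subcategories

variable (R : Type u) [CommRing R]

/-- A subcategory `𝒳` of `mod R` (full, closed under isomorphism; encoded as the collection of its
objects) is extension-closed if it is closed under direct summands and under extensions. -/
structure IsExtensionClosed (𝒳 : Set (FGModuleCat.{u} R)) : Prop where
  iso : ∀ M N : FGModuleCat.{u} R, M ∈ 𝒳 → Nonempty (M ≃ₗ[R] N) → N ∈ 𝒳
  summand : ∀ M N N' : FGModuleCat.{u} R, M ∈ 𝒳 → Nonempty (M ≃ₗ[R] (N × N')) → N ∈ 𝒳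
  extension : ∀ (L M N : FGModuleCat.{u} R) (f : L →ₗ[R] M) (g : M →ₗ[R] N),
    Function.Injective f → Function.Exact f g → Function.Surjective g →
    L ∈ 𝒳 → N ∈ 𝒳 → M ∈ 𝒳

/-- The extension closure `ext 𝒳`: the smallest extension-closed subcategory of `mod R`
containing `𝒳`. -/
def extClosure (𝒳 : Set (FGModuleCat.{u} R)) : Set (FGModuleCat.{u} R) :=
  ⋂₀ {𝒴 | IsExtensionClosed R 𝒴 ∧ 𝒳 ⊆ 𝒴}

theorem isExtensionClosed_extClosure (𝒳 : Set (FGModuleCat.{u} R)) :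
    IsExtensionClosed R (extClosure R 𝒳) where
  iso M N hM e 𝒴 h := h.1.iso M N (hM 𝒴 h) e
  summand M N N' hM e 𝒴 h := h.1.summand M N N' (hM 𝒴 h) e
  extension L M N f g hf hfg hg hL hN 𝒴 h :=
    h.1.extension L M N f g hf hfg hg (hL 𝒴 h) (hN 𝒴 h)

end Subcategories

section LocalRing

variable (R : Type u) [CommRing R] [IsLocalRing R]

/-- The depth of a finitely generated module over a local ring: the supremum of the lengths of
the `M`-regular sequences contained in the maximal ideal. For nonzero finitely generated `M` the
condition `M ≠ (x₁, …, xₙ) M` is automatic by Nakayama's lemma; it is left out so that the zero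
module has depth `∞`. -/
noncomputable def moduleDepth (M : Type u) [AddCommGroup M] [Module R M] : ℕ∞ :=
  ⨆ (xs : List R) (_ : (∀ x ∈ xs, x ∈ maximalIdeal R) ∧
    RingTheory.Sequence.IsWeaklyRegular M xs), (xs.length : ℕ∞)

/-- A (noetherian) local ring is Cohen-Macaulay if its depth equals its Krull dimension. -/
def IsCohenMacaulayLocalRing : Prop :=
  ((moduleDepth R R : ℕ∞) : WithBot ℕ∞) = ringKrullDim R

/-- `CM(R)`: the finitely generated modules `M` with `depth M = dim R`
(maximal Cohen-Macaulay modules), together with the zero module. -/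
def CM : Set (FGModuleCat.{u} R) :=
  {M | Subsingleton M ∨ ((moduleDepth R M : ℕ∞) : WithBot ℕ∞) = ringKrullDim R}

/-- `M` is free on the punctured spectrum: `M_𝔭` is a free `R_𝔭`-module for every nonmaximal
prime ideal `𝔭`. -/
def IsFreeOnPuncturedSpectrum (M : Type u) [AddCommGroup M] [Module R M] : Prop :=
  ∀ (p : Ideal R) [p.IsPrime], p ≠ maximalIdeal R →
    Module.Free (Localization.AtPrime p) (LocalizedModule p.primeCompl M)

/-- `R` has an isolated singularity: `R_𝔭` is a regular local ring for every nonmaximal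
prime ideal `𝔭`. -/
def HasIsolatedSingularity : Prop :=
  ∀ (p : Ideal R) [p.IsPrime], p ≠ maximalIdeal R → IsRegularLocalRing (Localization.AtPrime p)

/-- A minimal free resolution
`⋯ → R^{β₂} --∂₂--> R^{β₁} --∂₁--> R^{β₀} --ε--> M → 0`.
The field `d n` is the map `∂ₙ₊₁`; minimality says that the entries of the matrices of the `∂ₙ₊₁`
lie in the maximal ideal. -/
structure MinimalFreeResolution (M : Type u) [AddCommGroup M] [Module R M] where
  β : ℕ → ℕ
  ε : (Fin (β 0) → R) →ₗ[R] M
  d : ∀ n : ℕ, (Fin (β (n + 1)) → R) →ₗ[R] (Fin (β n) → R)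
  ε_surjective : Function.Surjective ε
  exact_zero : Function.Exact (d 0) ε
  exact_succ : ∀ n, Function.Exact (d (n + 1)) (d n)
  minimal : ∀ n x j, d n x j ∈ maximalIdeal R

/-- The `n`-th syzygy `Ωⁿ M` computed from a minimal free resolution: `Ω⁰ M = M`, and
`Ωⁿ⁺¹ M` is the image of `∂ₙ₊₁`. -/
def MinimalFreeResolution.syzygy {R : Type u} [CommRing R] [IsLocalRing R]
    {M : Type u} [AddCommGroup M] [Module R M] [Module.Finite R M]
    (F : MinimalFreeResolution R M) : ℕ → FGModuleCat.{u} R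
  | 0 => FGModuleCat.of R M
  | n + 1 => FGModuleCat.of R (LinearMap.range (F.d n))

theorem exists_minimal_cover (N : Type u) [AddCommGroup N] [Module R N] [Module.Finite R N] :
    ∃ (n : ℕ) (f : (Fin n → R) →ₗ[R] N), Function.Surjective f ∧
      ∀ x, f x = 0 → ∀ j, x j ∈ maximalIdeal R := by
  classical
  have hex : ∃ n, ∃ f : (Fin n → R) →ₗ[R] N, Function.Surjective f := Module.Finite.exists_fin' R N
  obtain ⟨f, hf⟩ := Nat.find_spec hex
  refine ⟨Nat.find hex, f, hf, fun x hx j => ?_⟩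
  by_contra hj
  have hu : IsUnit (x j) := by simpa [mem_maximalIdeal, mem_nonunits_iff] using hj
  have hmin : ∀ m, m < Nat.find hex → ¬ ∃ f : (Fin m → R) →ₗ[R] N, Function.Surjective f :=
    fun m hm => Nat.find_min hex hm
  generalize Nat.find hex = n at *
  cases n with
  | zero => exact j.elim0
  | succ m =>
    obtain ⟨c, hc⟩ := hu.exists_left_inv
    let ι : (Fin m → R) →ₗ[R] (Fin (m + 1) → R) :=
      { toFun := fun y => j.insertNth (0 : R) y
        map_add' := fun y z => by
          ext i
          refine Fin.succAboveCases j ?_ (fun k => ?_) i <;> simp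
        map_smul' := fun a y => by
          ext i
          refine Fin.succAboveCases j ?_ (fun k => ?_) i <;> simp }
    refine hmin m (Nat.lt_succ_self m) ⟨f.comp ι, fun y => ?_⟩
    obtain ⟨z, rfl⟩ := hf y
    refine ⟨fun k => (z - (z j * c) • x) (j.succAbove k), ?_⟩
    have : ι (fun k => (z - (z j * c) • x) (j.succAbove k)) = z - (z j * c) • x := by
      ext i
      refine Fin.succAboveCases j ?_ (fun k => ?_) i
      · simp [ι, mul_assoc, hc]
      · simp [ι]
    rw [LinearMap.comp_apply, this, map_sub, map_smul, hx, smul_zero, sub_zero]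

/-- Over a noetherian local ring every finitely generated module has a minimal free resolution. -/
theorem nonempty_minimalFreeResolution [IsNoetherianRing R]
    (M : Type u) [AddCommGroup M] [Module R M] [Module.Finite R M] :
    Nonempty (MinimalFreeResolution R M) := by
  obtain ⟨n₀, f₀, hf₀, hm₀⟩ := exists_minimal_cover R M
  have step : ∀ (n : ℕ) (K : Submodule R (Fin n → R)),
      ∃ (m : ℕ) (g : (Fin m → R) →ₗ[R] (Fin n → R)), LinearMap.range g = K ∧
        ∀ x, g x = 0 → ∀ j, x j ∈ maximalIdeal R := fun n K => by
    obtain ⟨m, f, hf, hm⟩ := exists_minimal_cover R K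
    refine ⟨m, K.subtype.comp f, ?_, fun x hx => hm x (by simpa using hx)⟩
    rw [LinearMap.range_comp, LinearMap.range_eq_top.2 hf, Submodule.map_top,
      Submodule.range_subtype]
  choose m g hg hgm using step
  let s : ℕ → Σ n : ℕ, Submodule R (Fin n → R) := fun i =>
    Nat.rec ⟨n₀, LinearMap.ker f₀⟩ (fun _ p => ⟨m p.1 p.2, LinearMap.ker (g p.1 p.2)⟩) i
  have hs : ∀ i, ∀ x ∈ (s i).2, ∀ j, x j ∈ maximalIdeal R := fun i => by
    cases i with
    | zero => exact fun x hx => hm₀ x hx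
    | succ i => exact fun x hx => hgm _ _ x hx
  exact ⟨
    { β := fun i => (s i).1
      ε := f₀
      d := fun i => g (s i).1 (s i).2
      ε_surjective := hf₀
      exact_zero := LinearMap.exact_iff.2 (hg _ _).symm
      exact_succ := fun i => LinearMap.exact_iff.2 (hg _ _).symm
      minimal := fun i x j => hs i _ ((hg (s i).1 (s i).2).le ⟨x, rfl⟩) j }⟩

end LocalRing

/-! Let 𝒳 be extension-closed and contain the syzygies of k in question. The ring elements whose
multiplication on M factors through a finite projective module form an ideal; freeness on the
punctured spectrum puts a power of 𝔪 inside it, so it contains an R-regular sequence of length d. If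
multiplication by x factors as M → B → M via α and β, then M is a retract of the kernel of B ⊕ M →
M, (b, y) ↦ β b + x y. With β surjective, this kernel is an extension of ker(B → M/xM) by (0 :_M x).
The first is a syzygy of M/xM up to the harmless term B, the second is zero or of finite length.
After d such reductions only modules of finite length remain, and these are built from k by
extensions (`iterCosyzygy_of_factorization`). Depth at least t kills (0 :_M x) during the first t
reductions, so only Ωⁱk with i ≥ t are needed.

Comparing syzygies modulo projectives requires R ∈ 𝒳 (`self_of_residueField`). For a maximal regular
sequence, R modulo the sequence has finite length, hence a d-th syzygy in 𝒳. This syzygy can be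
taken projective and is nonzero because the projective dimension is exactly d, so R is a summand of
it.

For an isolated singularity, localizations of maximal Cohen–Macaulay modules at nonmaximal primes
are maximal Cohen–Macaulay over regular rings, hence free. The reverse inclusion holds because Ωᵈk
has depth at least d. -/

/-! ### Depth via Ext and its bound by the dimension at associated primes. -/

section Depth

open CategoryTheory Abelian RingTheory.Sequence
open scoped Pointwise

/-- The depth of `M` is at least `n`. -/
def DepthGE (R : Type u) [CommRing R] [IsLocalRing R] (n : ℕ) (M : Type u) [AddCommGroup M]
    [Module R M] : Prop :=
  ∃ rs : List R, rs.length = n ∧ (∀ r ∈ rs, r ∈ maximalIdeal R) ∧ IsWeaklyRegular M rs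

variable {R : Type u} [CommRing R]

theorem ModuleCat.shortExact_of_linearMap {L M N : Type u} [AddCommGroup L] [Module R L]
    [AddCommGroup M] [Module R M] [AddCommGroup N] [Module R N] {f : L →ₗ[R] M} {g : M →ₗ[R] N}
    (hf : Function.Injective f) (hfg : Function.Exact f g) (hg : Function.Surjective g) :
    (ShortComplex.mk (ModuleCat.ofHom f) (ModuleCat.ofHom g)
      (by rw [← ModuleCat.ofHom_comp, hfg.linearMap_comp_eq_zero]; rfl)).ShortExact where
  exact := (ShortComplex.ShortExact.moduleCat_exact_iff_function_exact _).2 hfg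
  mono_f := (ModuleCat.mono_iff_injective _).2 hf
  epi_g := (ModuleCat.epi_iff_surjective _).2 hg

theorem subsingleton_ext_of_subsingleton (N M : Type u) [AddCommGroup N] [Module R N]
    [AddCommGroup M] [Module R M] [Subsingleton M] (i : ℕ) :
    Subsingleton (Ext (ModuleCat.of R N) (ModuleCat.of R M) i) := by
  have hid : 𝟙 (ModuleCat.of R M) = 0 :=
    (ModuleCat.isZero_of_subsingleton (ModuleCat.of R M)).eq_of_src _ _
  have key (e : Ext (ModuleCat.of R N) (ModuleCat.of R M) i) : e = 0 := by
    rw [← e.comp_mk₀_id, hid, Ext.mk₀_zero, Ext.comp_zero]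
  exact ⟨fun a b => (key a).trans (key b).symm⟩

variable [IsLocalRing R]

theorem smul_top_lt_top_of_le_maximalIdeal {I : Ideal R} (hI : I ≤ maximalIdeal R) (M : Type u)
    [AddCommGroup M] [Module R M] [Module.Finite R M] [Nontrivial M] :
    I • (⊤ : Submodule R M) < ⊤ := by
  refine lt_top_iff_ne_top.2 fun h => ?_
  exact Submodule.top_ne_ideal_smul_of_le_jacobson_annihilator
    (hI.trans (IsLocalRing.maximalIdeal_le_jacobson _)) h.symm

theorem DepthGE.of_linearEquiv {n : ℕ} {M N : Type u} [AddCommGroup M] [Module R M]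
    [AddCommGroup N] [Module R N] (e : M ≃ₗ[R] N) (h : DepthGE R n M) : DepthGE R n N := by
  obtain ⟨rs, hl, hm, hr⟩ := h
  exact ⟨rs, hl, hm, (e.isWeaklyRegular_congr rs).1 hr⟩

/-- In a module of positive depth no nonzero element is killed by a power of `𝔪`. -/
theorem DepthGE.eq_zero_of_pow_smul {M : Type u} [AddCommGroup M] [Module R M]
    (h : DepthGE R 1 M) {N : ℕ} {y : M} (hy : ∀ r ∈ maximalIdeal R ^ N, r • y = 0) : y = 0 := by
  obtain ⟨rs, hl, hm, hr⟩ := h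
  obtain ⟨x, rfl⟩ := List.length_eq_one_iff.1 hl
  have hx : IsSMulRegular M x := (isWeaklyRegular_singleton_iff M x).1 hr
  exact (hx.pow N).right_eq_zero_of_smul (hy _ (Ideal.pow_mem_pow (hm x (by simp)) N))

theorem support_residueField :
    Module.support R (ResidueField R) = PrimeSpectrum.zeroLocus (maximalIdeal R : Set R) := by
  have : Module.support R (R ⧸ maximalIdeal R) =
      PrimeSpectrum.zeroLocus (maximalIdeal R : Set R) := by
    rw [Module.support_eq_zeroLocus, Ideal.annihilator_quotient]
  exact this

variable [IsNoetherianRing R]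

/-- Rees' criterion with test module k. It turns the existence of a regular sequence into a
vanishing condition that can be followed along exact sequences. -/
theorem depthGE_iff_ext (n : ℕ) (M : Type u) [AddCommGroup M] [Module R M] [Module.Finite R M] :
    DepthGE R n M ↔ ∀ i < n,
      Subsingleton (Ext (ModuleCat.of R (ResidueField R)) (ModuleCat.of R M) i) := by
  cases subsingleton_or_nontrivial M with
  -- Over the zero module a list of n zeros is weakly regular, so every depth bound holds.
  | inl h =>
    refine iff_of_true ⟨List.replicate n 0, by simp, by simp +contextual [List.mem_replicate],
      ⟨fun i _ => fun _ _ _ => Subsingleton.elim _ _⟩⟩ fun i _ => ?_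
    exact subsingleton_ext_of_subsingleton _ _ i
  | inr h =>
    have key := ModuleCat.exists_isRegular_tfae (maximalIdeal R) n (ModuleCat.of R M)
      (smul_top_lt_top_of_le_maximalIdeal le_rfl M)
    constructor
    · rintro ⟨rs, hl, hm, hr⟩
      have k : (∃ rs : List R, rs.length = n ∧ (∀ r ∈ rs, r ∈ maximalIdeal R) ∧ IsRegular M rs) →
        ∀ N : ModuleCat.{u} R, Nontrivial N → Module.Finite R N → Module.support R N ⊆
          PrimeSpectrum.zeroLocus (maximalIdeal R) → ∀ i < n,
            Subsingleton (Ext N (ModuleCat.of R M) i) := (key.out 3 0).1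
      exact k ⟨rs, hl, hm,
        (IsLocalRing.isRegular_iff_isWeaklyRegular_of_subset_maximalIdeal hm).2 hr⟩
        (ModuleCat.of R (ResidueField R)) inferInstance inferInstance support_residueField.subset
    · intro h
      have k : (∃ N : ModuleCat.{u} R, Nontrivial N ∧ Module.Finite R N ∧ Module.support R N =
          PrimeSpectrum.zeroLocus (maximalIdeal R) ∧ ∀ i < n,
            Subsingleton (Ext N (ModuleCat.of R M) i)) →
        ∃ rs : List R, rs.length = n ∧ (∀ r ∈ rs, r ∈ maximalIdeal R) ∧ IsRegular M rs :=
          (key.out 2 3).1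
      obtain ⟨rs, hl, hm, hr⟩ := k ⟨ModuleCat.of R (ResidueField R), inferInstance,
        inferInstance, support_residueField, h⟩
      exact ⟨rs, hl, hm, hr.1⟩

/-- A regular sequence of length `n` can be chosen in any `𝔪`-primary ideal. -/
theorem DepthGE.exists_isWeaklyRegular_of_pow_le {n N : ℕ} {M : Type u} [AddCommGroup M]
    [Module R M] [Module.Finite R M] [Nontrivial M] (h : DepthGE R n M) {I : Ideal R}
    (hI : I ≤ maximalIdeal R) (hN : maximalIdeal R ^ N ≤ I) :
    ∃ rs : List R, rs.length = n ∧ (∀ r ∈ rs, r ∈ I) ∧ IsWeaklyRegular M rs := by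
  obtain ⟨rs, hl, hm, hr⟩ := h
  have h1 : (∃ rs : List R, rs.length = n ∧ (∀ r ∈ rs, r ∈ maximalIdeal R) ∧ IsRegular M rs) →
      ∀ N : ModuleCat.{u} R, Nontrivial N → Module.Finite R N → Module.support R N ⊆
        PrimeSpectrum.zeroLocus (maximalIdeal R) → ∀ i < n,
          Subsingleton (Ext N (ModuleCat.of R M) i) :=
    ((ModuleCat.exists_isRegular_tfae (maximalIdeal R) n (ModuleCat.of R M)
      (smul_top_lt_top_of_le_maximalIdeal le_rfl M)).out 3 0).1
  have hs : Module.support R (R ⧸ I) = PrimeSpectrum.zeroLocus (I : Set R) := by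
    rw [Module.support_eq_zeroLocus, Ideal.annihilator_quotient]
  have hle : PrimeSpectrum.zeroLocus (I : Set R) ⊆
      PrimeSpectrum.zeroLocus (maximalIdeal R : Set R) := fun p hp => by
    have : maximalIdeal R ^ N ≤ p.asIdeal := hN.trans hp
    exact Ideal.IsPrime.le_of_pow_le this
  have hnt : Nontrivial (R ⧸ I) := Ideal.Quotient.nontrivial_iff.2
    fun h => (maximalIdeal.isMaximal R).ne_top (top_le_iff.1 (h ▸ hI))
  have h2 : (∃ N : ModuleCat.{u} R, Nontrivial N ∧ Module.Finite R N ∧ Module.support R N =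
      PrimeSpectrum.zeroLocus I ∧ ∀ i < n, Subsingleton (Ext N (ModuleCat.of R M) i)) →
      ∃ rs : List R, rs.length = n ∧ (∀ r ∈ rs, r ∈ I) ∧ IsRegular M rs :=
    ((ModuleCat.exists_isRegular_tfae I n (ModuleCat.of R M)
      (smul_top_lt_top_of_le_maximalIdeal hI M)).out 2 3).1
  obtain ⟨rs, hl, hm, hr⟩ := h2 ⟨ModuleCat.of R (R ⧸ I), hnt, inferInstance, hs,
    h1 ⟨rs, hl, hm,
      (IsLocalRing.isRegular_iff_isWeaklyRegular_of_subset_maximalIdeal hm).2 hr⟩ _ hnt inferInstance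
      (hs.subset.trans hle)⟩
  exact ⟨rs, hl, hm, hr.1⟩

theorem DepthGE.mono {m n : ℕ} (h : m ≤ n) {M : Type u} [AddCommGroup M] [Module R M]
    [Module.Finite R M] (hM : DepthGE R n M) : DepthGE R m M := by
  rw [depthGE_iff_ext] at *
  exact fun i hi => hM i (hi.trans_le h)

theorem DepthGE.fst {n : ℕ} {M N : Type u} [AddCommGroup M] [Module R M] [Module.Finite R M]
    [AddCommGroup N] [Module R N] [Module.Finite R N] (h : DepthGE R n (M × N)) :
    DepthGE R n M := by
  rw [depthGE_iff_ext] at *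
  intro i hi
  have := h i hi
  have hid : ModuleCat.ofHom (LinearMap.inl R M N) ≫ ModuleCat.ofHom (LinearMap.fst R M N)
      = 𝟙 (ModuleCat.of R M) := by
    rw [← ModuleCat.ofHom_comp, LinearMap.fst_comp_inl]; rfl
  have key (e : Ext (ModuleCat.of R (ResidueField R)) (ModuleCat.of R M) i) : e = 0 := by
    have h0 : e.comp (Ext.mk₀ (ModuleCat.ofHom (LinearMap.inl R M N))) (add_zero i) = 0 :=
      Subsingleton.elim _ _
    have h1 : (e.comp (Ext.mk₀ (ModuleCat.ofHom (LinearMap.inl R M N))) (add_zero i)).comp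
      (Ext.mk₀ (ModuleCat.ofHom (LinearMap.fst R M N))) (add_zero i) = e := by
      rw [Ext.comp_assoc_of_third_deg_zero, Ext.mk₀_comp_mk₀, hid, Ext.comp_mk₀_id]
    rw [← h1, h0, Ext.zero_comp]
  exact ⟨fun a b => (key a).trans (key b).symm⟩

section Exact

variable {L M N : Type u} [AddCommGroup L] [Module R L] [Module.Finite R L]
  [AddCommGroup M] [Module R M] [Module.Finite R M] [AddCommGroup N] [Module R N]
  [Module.Finite R N] {f : L →ₗ[R] M} {g : M →ₗ[R] N}

/-- This and the next two lemmas form the depth lemma, read off from the long exact sequence of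
Ext(k, -). -/
theorem DepthGE.of_exact (hf : Function.Injective f) (hfg : Function.Exact f g)
    (hg : Function.Surjective g) {n : ℕ} (hL : DepthGE R n L) (hN : DepthGE R n N) :
    DepthGE R n M := by
  rw [depthGE_iff_ext] at *
  intro i hi
  exact AddCommGrpCat.subsingleton_of_isZero <| ShortComplex.Exact.isZero_of_both_zeros
    (Ext.covariant_sequence_exact₂' (ModuleCat.of R (ResidueField R))
      (ModuleCat.shortExact_of_linearMap hf hfg hg) i)
    ((AddCommGrpCat.isZero_of_iff_subsingleton.mpr (hL i hi)).eq_zero_of_src _)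
    ((AddCommGrpCat.isZero_of_iff_subsingleton.mpr (hN i hi)).eq_zero_of_tgt _)

theorem DepthGE.left_of_exact (hf : Function.Injective f) (hfg : Function.Exact f g)
    (hg : Function.Surjective g) {n : ℕ} (hM : DepthGE R (n + 1) M) (hN : DepthGE R n N) :
    DepthGE R (n + 1) L := by
  rw [depthGE_iff_ext] at *
  rintro (_ | i) hi
  · have := hM 0 hi
    have := (ModuleCat.mono_iff_injective (ModuleCat.ofHom f)).2 hf
    exact (Ext.postcomp_mk₀_injective_of_mono (ModuleCat.of R (ResidueField R))
      (ModuleCat.ofHom f)).subsingleton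
  · exact AddCommGrpCat.subsingleton_of_isZero <| ShortComplex.Exact.isZero_of_both_zeros
      (Ext.covariant_sequence_exact₁' (ModuleCat.of R (ResidueField R))
        (ModuleCat.shortExact_of_linearMap hf hfg hg) i (i + 1) rfl)
      ((AddCommGrpCat.isZero_of_iff_subsingleton.mpr (hN i (by omega))).eq_zero_of_src _)
      ((AddCommGrpCat.isZero_of_iff_subsingleton.mpr (hM (i + 1) hi)).eq_zero_of_tgt _)

theorem DepthGE.right_of_exact (hf : Function.Injective f) (hfg : Function.Exact f g)
    (hg : Function.Surjective g) {n : ℕ} (hL : DepthGE R (n + 1) L) (hM : DepthGE R n M) :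
    DepthGE R n N := by
  rw [depthGE_iff_ext] at *
  intro i hi
  exact AddCommGrpCat.subsingleton_of_isZero <| ShortComplex.Exact.isZero_of_both_zeros
    (Ext.covariant_sequence_exact₃' (ModuleCat.of R (ResidueField R))
      (ModuleCat.shortExact_of_linearMap hf hfg hg) i (i + 1) rfl)
    ((AddCommGrpCat.isZero_of_iff_subsingleton.mpr (hM i hi)).eq_zero_of_src _)
    ((AddCommGrpCat.isZero_of_iff_subsingleton.mpr (hL (i + 1) (by omega))).eq_zero_of_tgt _)

end Exact

theorem DepthGE.quotSMulTop {n : ℕ} {M : Type u} [AddCommGroup M] [Module R M] [Module.Finite R M]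
    {x : R} (hx : IsSMulRegular M x) (h : DepthGE R (n + 1) M) :
    DepthGE R n (QuotSMulTop x M) := by
  have hex : Function.Exact (LinearMap.lsmul R M x) (x • (⊤ : Submodule R M)).mkQ :=
    LinearMap.exact_lsmul_mkQ_smul_top M x
  exact DepthGE.right_of_exact (f := LinearMap.lsmul R M x) hx hex
    (Submodule.mkQ_surjective _) h (h.mono (Nat.le_succ n))

/-- The depth of `M` is at most `dim R/𝔮` for every associated prime `𝔮` of `M`. -/
theorem DepthGE.le_ringKrullDim_quotient {n : ℕ} {M : Type u} [AddCommGroup M] [Module R M]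
    [Module.Finite R M] (h : DepthGE R n M) {q : Ideal R} (hq : IsAssociatedPrime q M) :
    (n : WithBot ℕ∞) ≤ ringKrullDim (R ⧸ q) := by
  induction n generalizing M q with
  | zero =>
    have := hq.isPrime
    have : Nontrivial (R ⧸ q) := Ideal.Quotient.nontrivial_iff.2 hq.isPrime.ne_top
    simpa using ringKrullDim_nonneg_of_nontrivial
  | succ n ih =>
    have hqp := hq.isPrime
    obtain ⟨rs, hl, hm, hr⟩ := h
    obtain ⟨x, rs, rfl⟩ : ∃ x l, rs = x :: l := by
      cases rs with
      | nil => simp at hl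
      | cons x l => exact ⟨x, l, rfl⟩
    rw [isWeaklyRegular_cons_iff] at hr
    have hxm : x ∈ maximalIdeal R := hm x (by simp)
    have hd : DepthGE R n (QuotSMulTop x M) :=
      ⟨rs, by simpa using hl, fun r hr => hm r (by simp [hr]), hr.2⟩
    obtain ⟨u, hu⟩ := (isAssociatedPrime_iff.1 hq).2
    have hmem (r : R) : r ∈ q ↔ r • u = 0 := by rw [hu]; simp
    -- The submodule of elements killed by q. If U ⊆ xM, regularity of x gives U = xU, contradicting
    -- Nakayama. An element of U outside xM then yields an associated prime of M/xM that contains q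
    -- and x. Since x ∉ q, it is strictly larger and the dimension of the quotient drops.
    let U : Submodule R M :=
      { carrier := {v | ∀ r ∈ q, r • v = 0}
        add_mem' := fun ha hb r hr => by rw [smul_add, ha r hr, hb r hr, add_zero]
        zero_mem' := fun r _ => smul_zero r
        smul_mem' := fun c v hv r hr => by rw [smul_comm, hv r hr, smul_zero] }
    have hUne : U ≠ ⊥ := fun hU => by
      have : u ∈ U := fun r hr => (hmem r).1 hr
      rw [hU, Submodule.mem_bot] at this
      exact hqp.ne_top ((Ideal.eq_top_iff_one _).2 ((hmem 1).2 (by simp [this])))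
    have hUx : ¬ U ≤ x • (⊤ : Submodule R M) := fun hle => hUne <| by
      refine Submodule.eq_bot_of_le_smul_of_le_jacobson_bot (Ideal.span {x}) U
        (IsNoetherian.noetherian U) ?_ ?_
      · intro v hv
        obtain ⟨w, -, rfl⟩ := (Submodule.mem_smul_pointwise_iff_exists _ _ _).1 (hle hv)
        refine Submodule.smul_mem_smul (Ideal.mem_span_singleton_self x) fun r hr' => ?_
        exact hr.1.right_eq_zero_of_smul (by rw [smul_comm]; exact hv r hr')
      · rw [IsLocalRing.jacobson_eq_maximalIdeal ⊥ bot_ne_top, Ideal.span_singleton_le_iff_mem]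
        exact hxm
    obtain ⟨v, hvU, hvx⟩ := SetLike.not_le_iff_exists.1 hUx
    obtain ⟨q', hq', hle⟩ := exists_le_isAssociatedPrime_of_isNoetherianRing R
      (Submodule.Quotient.mk v : QuotSMulTop x M)
      (by rwa [Ne, Submodule.Quotient.mk_eq_zero])
    have hq'p := hq'.isPrime
    have hqq' : q < q' := by
      refine lt_of_le_of_ne (fun r hr => hle ?_) fun heq => ?_
      · simp only [Submodule.mem_colon_singleton, Submodule.mem_bot]
        rw [← Submodule.Quotient.mk_smul, hvU r hr, Submodule.Quotient.mk_zero]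
      · have : x ∈ q' := hle <| by
          simp only [Submodule.mem_colon_singleton, Submodule.mem_bot]
          exact Module.mem_annihilator.1 (QuotSMulTop.mem_annihilator M x) _
        rw [← heq, hmem] at this
        have hu0 := hr.1.right_eq_zero_of_smul this
        exact hqp.ne_top ((Ideal.eq_top_iff_one _).2 ((hmem 1).2 (by simp [hu0])))
    have := ih hd hq'
    obtain ⟨y, hy, hyq⟩ := SetLike.exists_of_lt hqq'
    have key := ringKrullDim_succ_le_of_surjective (Ideal.Quotient.factor hqq'.le)
      (Ideal.Quotient.factor_surjective hqq'.le) (r := Ideal.Quotient.mk q y)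
      (mem_nonZeroDivisors_of_ne_zero (by rwa [Ne, Ideal.Quotient.eq_zero_iff_mem]))
      (by simpa [Ideal.Quotient.eq_zero_iff_mem] using hy)
    push_cast
    exact (add_le_add_left this 1).trans key

theorem DepthGE.le_of_nontrivial {n d : ℕ} (hd : ringKrullDim R = d) {M : Type u} [AddCommGroup M]
    [Module R M] [Module.Finite R M] [Nontrivial M] (h : DepthGE R n M) : n ≤ d := by
  obtain ⟨q, hq⟩ := associatedPrimes.nonempty R M
  have := (h.le_ringKrullDim_quotient hq).trans (ringKrullDim_quotient_le q)
  rw [hd] at this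
  exact_mod_cast this

theorem le_moduleDepth_iff {n : ℕ} {M : Type u} [AddCommGroup M] [Module R M]
    [Module.Finite R M] : (n : ℕ∞) ≤ moduleDepth R M ↔ DepthGE R n M := by
  constructor
  · intro h
    by_contra hn
    have hn0 : n ≠ 0 := by
      rintro rfl
      exact hn ⟨[], rfl, by simp, .nil R M⟩
    -- If no sequence has length n, monotonicity excludes longer ones; n ≠ 0 makes the truncated n -
    -- 1 meaningful.
    have : moduleDepth R M ≤ (n - 1 : ℕ) := by
      refine iSup₂_le fun xs hxs => ?_
      by_contra hlt
      have hlt : n - 1 < xs.length := by exact_mod_cast not_le.1 hlt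
      exact hn (DepthGE.mono (by omega) ⟨xs, rfl, hxs.1, hxs.2⟩)
    have : n ≤ n - 1 := by exact_mod_cast h.trans this
    omega
  · rintro ⟨rs, rfl, hm, hr⟩
    exact le_iSup₂ (f := fun (xs : List R) (_ : (∀ x ∈ xs, x ∈ maximalIdeal R) ∧
      IsWeaklyRegular M xs) => (xs.length : ℕ∞)) rs ⟨hm, hr⟩

/-- Nonzero modules have depth at most d, so equality reduces to an inequality; the zero module
satisfies every lower bound, which absorbs the separate clause. -/
theorem mem_CM_iff {d : ℕ} (hd : ringKrullDim R = d) (M : FGModuleCat.{u} R) :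
    M ∈ CM R ↔ DepthGE R d M := by
  cases subsingleton_or_nontrivial M with
  | inl h =>
    refine iff_of_true (Or.inl h) ((depthGE_iff_ext d M).2 fun i _ => ?_)
    exact subsingleton_ext_of_subsingleton _ _ i
  | inr h =>
    have hle : moduleDepth R M ≤ d := by
      refine ENat.forall_natCast_le_iff_le.1 fun a ha => ?_
      exact_mod_cast (le_moduleDepth_iff.1 ha).le_of_nontrivial hd
    rw [← le_moduleDepth_iff]
    constructor
    · rintro (h' | h')
      · exact (not_subsingleton M h').elim
      · rw [hd] at h'
        exact le_of_eq (by exact_mod_cast h'.symm)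
    · intro h'
      right
      rw [hd, le_antisymm hle h']
      rfl

end Depth

/-! ### Classes of modules with a syzygy in a given class. -/

section ModuleClasses

/-- Classes of `R`-modules, encoded as predicates. -/
abbrev ModuleClass (R : Type u) [CommRing R] : Type (u + 1) :=
  ∀ (M : Type u) [AddCommGroup M] [Module R M], Prop

variable {R : Type u} [CommRing R]

/-- A class of modules containing `0` and closed under isomorphisms and extensions. -/
structure ModuleClass.IsExtensionStable (P : ModuleClass R) : Prop where
  zero : P PUnit.{u + 1}
  iso : ∀ {M N : Type u} [AddCommGroup M] [Module R M] [AddCommGroup N] [Module R N],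
    (M ≃ₗ[R] N) → P M → P N
  extension : ∀ {L M N : Type u} [AddCommGroup L] [Module R L] [AddCommGroup M] [Module R M]
    [AddCommGroup N] [Module R N] {f : L →ₗ[R] M} {g : M →ₗ[R] N}, Function.Injective f →
    Function.Exact f g → Function.Surjective g → P L → P N → P M

/-- An extension-stable class of finite modules closed under direct summands and containing `R`. -/
structure ModuleClass.IsSummandStable (P : ModuleClass R) : Prop extends P.IsExtensionStable where
  finite : ∀ {M : Type u} [AddCommGroup M] [Module R M], P M → Module.Finite R M
  summand : ∀ {M N : Type u} [AddCommGroup M] [Module R M] [AddCommGroup N] [Module R N],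
    P (M × N) → P M
  self : P R

/-- The class of modules having a finite projective cover with kernel in `P`. -/
def ModuleClass.cosyzygy (P : ModuleClass R) : ModuleClass R := fun M _ _ =>
  ∃ (F : Type u) (_ : AddCommGroup F) (_ : Module R F) (_ : Module.Finite R F)
    (_ : Module.Projective R F) (f : F →ₗ[R] M), Function.Surjective f ∧ P (LinearMap.ker f)

/-- The intersection of two classes of modules. -/
def ModuleClass.inter (P Q : ModuleClass R) : ModuleClass R := fun M _ _ => P M ∧ Q M

/-- The class of modules with an `n`-th syzygy in `P`. -/
def ModuleClass.iterCosyzygy (P : ModuleClass R) : ℕ → ModuleClass R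
  | 0 => P
  | n + 1 => (ModuleClass.iterCosyzygy P n).cosyzygy

namespace ModuleClass

section Retract

variable {M N : Type u} [AddCommGroup M] [Module R M] [AddCommGroup N] [Module R N]

theorem nonempty_linearEquiv_prod_of_retract {i : N →ₗ[R] M} {p : M →ₗ[R] N}
    (h : ∀ y, p (i y) = y) : Nonempty (M ≃ₗ[R] N × LinearMap.ker p) := by
  refine ⟨LinearEquiv.ofLinearMap
    (p.prod ((LinearMap.id - i ∘ₗ p).codRestrict _ fun y => by simp [h]))
    (i.coprod (LinearMap.ker p).subtype) ?_ ?_⟩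
  · ext y <;> simp [h]
  · ext y; simp

end Retract

namespace IsExtensionStable

variable {P : ModuleClass R}

theorem of_subsingleton (hP : P.IsExtensionStable) {M : Type u} [AddCommGroup M] [Module R M]
    [Subsingleton M] : P M :=
  hP.iso (0 : PUnit.{u + 1} ≃ₗ[R] M) hP.zero

theorem prod (hP : P.IsExtensionStable) {M N : Type u} [AddCommGroup M] [Module R M]
    [AddCommGroup N] [Module R N] (hM : P M) (hN : P N) : P (M × N) :=
  hP.extension (f := LinearMap.inl R M N) (g := LinearMap.snd R M N) LinearMap.inl_injective
    (Function.Exact.inl_snd) LinearMap.snd_surjective hM hN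

theorem cosyzygy_of_exact (hP : P.IsExtensionStable) {K F M : Type u} [AddCommGroup K] [Module R K]
    [AddCommGroup F] [Module R F] [AddCommGroup M] [Module R M] [Module.Finite R F]
    [Module.Projective R F] {f : K →ₗ[R] F} {g : F →ₗ[R] M} (hf : Function.Injective f)
    (hfg : Function.Exact f g) (hg : Function.Surjective g) (hK : P K) : P.cosyzygy M :=
  ⟨F, _, _, ‹_›, ‹_›, g, hg, hP.iso
    (LinearEquiv.ofInjective f hf ≪≫ₗ LinearEquiv.ofEq _ _ hfg.linearMap_ker_eq.symm) hK⟩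

/-- If `0 → A → B → C → 0` is exact with `A ∈ P` and `B` with a syzygy in `P`, then `C` has a
syzygy in `P`. -/
theorem cosyzygy_of_left_of_middle (hP : P.IsExtensionStable) {A B C : Type u} [AddCommGroup A]
    [Module R A] [AddCommGroup B] [Module R B] [AddCommGroup C] [Module R C] {f : A →ₗ[R] B}
    {g : B →ₗ[R] C} (hf : Function.Injective f) (hfg : Function.Exact f g)
    (hg : Function.Surjective g) (hA : P A) (hB : P.cosyzygy B) : P.cosyzygy C := by
  obtain ⟨F, _, _, _, _, h, hh, hK⟩ := hB
  refine ⟨F, _, _, ‹_›, ‹_›, g ∘ₗ h, hg.comp hh, ?_⟩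
  -- The kernel of F → B → C is an extension of ker(B → C) ≅ A by ker(F → B).
  let e : LinearMap.range f ≃ₗ[R] A := (LinearEquiv.ofInjective f hf).symm
  refine hP.extension (L := LinearMap.ker h) (N := LinearMap.range f)
    (f := Submodule.inclusion fun x hx => by
      rw [LinearMap.mem_ker] at hx; simp [hx])
    (g := (h ∘ₗ (LinearMap.ker (g ∘ₗ h)).subtype).codRestrict _ fun x =>
      (hfg _).1 (LinearMap.mem_ker.1 x.2))
    (Submodule.inclusion_injective _) ?_ ?_ hK (hP.iso e.symm hA)
  · rintro ⟨x, hx⟩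
    constructor
    · intro h0
      have h0 : h x = 0 := congrArg Subtype.val h0
      exact ⟨⟨x, h0⟩, rfl⟩
    · rintro ⟨y, hy⟩
      have : (y : F) = x := congrArg Subtype.val hy
      refine Subtype.ext ?_
      change h x = 0
      rw [← this]
      exact y.2
  · rintro ⟨y, hy⟩
    obtain ⟨x, rfl⟩ := hh y
    exact ⟨⟨x, LinearMap.mem_ker.2 ((hfg _).2 hy)⟩, rfl⟩

/-- The horseshoe lemma. Neither R ∈ P nor closure under summands is required, which allows its use
before R ∈ P is known. -/
theorem cosyzygy (hP : P.IsExtensionStable) : P.cosyzygy.IsExtensionStable where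
  zero := ⟨PUnit, _, _, inferInstance, inferInstance, 0, fun _ => ⟨0, rfl⟩, hP.of_subsingleton⟩
  iso e := by
    rintro ⟨F, _, _, _, _, f, hf, hK⟩
    exact ⟨F, _, _, ‹_›, ‹_›, e.toLinearMap ∘ₗ f, e.surjective.comp hf,
      hP.iso (LinearEquiv.ofEq _ _ (by simp [LinearEquiv.ker_comp])) hK⟩
  extension {L M N} _ _ _ _ _ _ f g hf hfg hg := by
    rintro ⟨F, _, _, _, _, a, ha, hKa⟩ ⟨G, _, _, _, _, b, hb, hKb⟩
    obtain ⟨c, hc⟩ := Module.projective_lifting_property g b hg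
    have hc (y : G) : g (c y) = b y := LinearMap.congr_fun hc y
    have hgf (x : L) : g (f x) = 0 := hfg.apply_apply_eq_zero x
    refine ⟨F × G, _, _, inferInstance, inferInstance, (f ∘ₗ a).coprod c, fun m => ?_, ?_⟩
    · obtain ⟨y, hy⟩ := hb (g m)
      obtain ⟨l, hl⟩ := (hfg (m - c y)).1 (by rw [map_sub, hc, hy, sub_self])
      obtain ⟨x, rfl⟩ := ha l
      exact ⟨(x, y), by simp [hl]⟩
    · refine hP.extension (L := LinearMap.ker a) (N := LinearMap.ker b)
        (f := (LinearMap.inl R F G ∘ₗ (LinearMap.ker a).subtype).codRestrict _ fun x => by simp)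
        (g := (LinearMap.snd R F G ∘ₗ (LinearMap.ker ((f ∘ₗ a).coprod c)).subtype).codRestrict _
          fun x => ?_) ?_ ?_ ?_ hKa hKb
      · have h0 : f (a x.1.1) + c x.1.2 = 0 := x.2
        have := congrArg g h0
        rwa [map_add, hgf, hc, zero_add, map_zero] at this
      · intro x y hxy
        have := congrArg (fun z => z.1.1) hxy
        exact Subtype.ext this
      · rintro ⟨⟨x, y⟩, hxy⟩
        constructor
        · intro h0
          obtain rfl : y = 0 := congrArg Subtype.val h0
          refine ⟨⟨x, LinearMap.mem_ker.2 (hf ?_)⟩, rfl⟩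
          simpa using hxy
        · rintro ⟨z, hz⟩
          exact Subtype.ext (congrArg (fun z => z.1.2) hz).symm
      · rintro ⟨y, hy⟩
        obtain ⟨l, hl⟩ := (hfg (- c y)).1 (by rw [map_neg, hc, LinearMap.mem_ker.1 hy, neg_zero])
        obtain ⟨x, rfl⟩ := ha l
        exact ⟨⟨(x, y), by simp [hl]⟩, rfl⟩

theorem iterCosyzygy (hP : P.IsExtensionStable) (n : ℕ) : (P.iterCosyzygy n).IsExtensionStable := by
  induction n with
  | zero => exact hP
  | succ n ih => exact ih.cosyzygy

/-- An extension-stable class containing the residue field contains all modules of finite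
length. -/
theorem of_pow_smul_eq_zero [IsLocalRing R] [IsNoetherianRing R] (hP : P.IsExtensionStable)
    (hk : P (ResidueField R)) {M : Type u} [AddCommGroup M] [Module R M] [hM : Module.Finite R M]
    {n : ℕ} (h : ∀ r ∈ maximalIdeal R ^ n, ∀ y : M, r • y = 0) : P M := by
  revert h
  induction hM using IsNoetherianRing.induction_on_isQuotientEquivQuotientPrime R with
  | subsingleton N => exact fun _ => hP.of_subsingleton
  | quotient N p e =>
    intro h
    -- In a prime filtration every factor R/p is killed by 𝔪ⁿ, which forces p = 𝔪.
    have hle : maximalIdeal R ^ n ≤ p.1 := fun r hr => by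
      have := congrArg e (h r hr (e.symm 1))
      rw [map_smul, e.apply_symm_apply, map_zero] at this
      rw [← Ideal.Quotient.eq_zero_iff_mem]
      simpa [Algebra.smul_def] using this
    have hp : p.1 = maximalIdeal R := le_antisymm (le_maximalIdeal p.2.ne_top)
      (Ideal.IsPrime.le_of_pow_le hle)
    exact hP.iso ((Submodule.quotEquivOfEq _ _ hp.symm).trans e.symm : ResidueField R ≃ₗ[R] N) hk
  | exact N₁ N₂ N₃ f g hf hg hfg h₁ h₃ =>
    intro h
    refine hP.extension hf hfg hg (h₁ fun r hr y => hf ?_) (h₃ fun r hr y => ?_)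
    · rw [map_smul, h r hr, map_zero]
    · obtain ⟨y, rfl⟩ := hg y
      rw [← map_smul, h r hr, map_zero]

end IsExtensionStable

namespace IsSummandStable

variable {P : ModuleClass R}

theorem of_retract (hP : P.IsSummandStable) {M N : Type u} [AddCommGroup M] [Module R M]
    [AddCommGroup N] [Module R N] {i : N →ₗ[R] M} {p : M →ₗ[R] N} (h : ∀ y, p (i y) = y)
    (hM : P M) : P N := by
  obtain ⟨e⟩ := nonempty_linearEquiv_prod_of_retract h
  exact hP.summand (hP.iso e hM)

theorem pi (hP : P.IsSummandStable) (n : ℕ) : P (Fin n → R) := by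
  induction n with
  | zero => exact hP.of_subsingleton
  | succ n ih => exact hP.iso (Fin.consLinearEquiv R fun _ => R) (hP.prod hP.self ih)

theorem of_projective (hP : P.IsSummandStable) {F : Type u} [AddCommGroup F] [Module R F]
    [Module.Finite R F] [Module.Projective R F] : P F := by
  obtain ⟨n, f, hf⟩ := Module.Finite.exists_fin' R F
  obtain ⟨s, hs⟩ := Module.projective_lifting_property f LinearMap.id hf
  exact hP.of_retract (i := s) (p := f) (LinearMap.congr_fun hs) (hP.pi n)

/-- If `0 → L → A → C → 0` is exact with `A ∈ P` and `C` with a syzygy in `P`, then `L ∈ P`. -/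
theorem left_of_exact (hP : P.IsSummandStable) {L A C : Type u} [AddCommGroup L]
    [Module R L] [AddCommGroup A] [Module R A] [AddCommGroup C] [Module R C] {f : L →ₗ[R] A}
    {g : A →ₗ[R] C} (hf : Function.Injective f) (hfg : Function.Exact f g)
    (hg : Function.Surjective g) (hA : P A) (hC : P.cosyzygy C) : P L := by
  obtain ⟨F, _, _, _, _, h, hh, hK⟩ := hC
  -- The pullback of A → C ← F. Projecting to A shows it lies in P; projecting to F splits, with
  -- kernel L, so L is a retract.
  let Q := LinearMap.ker (g ∘ₗ LinearMap.fst R A F - h ∘ₗ LinearMap.snd R A F)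
  have hmem (z : A × F) : z ∈ Q ↔ g z.1 = h z.2 := by simp [Q, sub_eq_zero]
  have hgf (x : L) : g (f x) = 0 := hfg.apply_apply_eq_zero x
  have hQ : P Q := by
    refine hP.extension (L := LinearMap.ker h) (N := A)
      (f := (LinearMap.inr R A F ∘ₗ (LinearMap.ker h).subtype).codRestrict Q fun x => ?_)
      (g := LinearMap.fst R A F ∘ₗ Q.subtype) ?_ ?_ ?_ hK hA
    · rw [hmem]; simp
    · intro x y hxy
      exact Subtype.ext (congrArg (fun z => z.1.2) hxy)
    · rintro ⟨⟨x, y⟩, hxy⟩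
      constructor
      · intro h0
        obtain rfl : x = 0 := h0
        refine ⟨⟨y, ?_⟩, rfl⟩
        simpa using ((hmem _).1 hxy).symm
      · rintro ⟨z, hz⟩
        exact (congrArg (fun z => z.1.1) hz).symm
    · intro x
      obtain ⟨y, hy⟩ := hh (g x)
      exact ⟨⟨(x, y), (hmem _).2 hy.symm⟩, rfl⟩
  let i : L →ₗ[R] Q := (LinearMap.inl R A F ∘ₗ f).codRestrict Q fun x => by
    rw [hmem]; simp [hgf]
  obtain ⟨s, hs⟩ := Module.projective_lifting_property g h hg
  have hs (y : F) : g (s y) = h y := LinearMap.congr_fun hs y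
  let q : Q →ₗ[R] LinearMap.range f :=
    ((LinearMap.fst R A F - s ∘ₗ LinearMap.snd R A F) ∘ₗ Q.subtype).codRestrict _ fun z =>
      (hfg _).1 (by
        have := (hmem _).1 z.2
        simp [hs, this])
  refine hP.of_retract (i := i) (p := (LinearEquiv.ofInjective f hf).symm.toLinearMap ∘ₗ q)
    (fun y => ?_) hQ
  have : q (i y) = LinearEquiv.ofInjective f hf y := Subtype.ext (by
    change f y - s 0 = f y
    rw [map_zero, sub_zero])
  simp [this]

/-- Closure under summands is the delicate point. By `left_of_exact` membership of a syzygy in P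
does not depend on the cover, so a product of free covers may be used and its kernel splits
accordingly. -/
theorem cosyzygy (hP : P.IsSummandStable) : P.cosyzygy.IsSummandStable where
  toIsExtensionStable := hP.toIsExtensionStable.cosyzygy
  finite := by
    rintro M _ _ ⟨F, _, _, _, _, f, hf, -⟩
    exact Module.Finite.of_surjective f hf
  summand {M N} _ _ _ _ h := by
    have hfin : Module.Finite R (M × N) := by
      obtain ⟨F, _, _, _, _, f, hf, -⟩ := h
      exact Module.Finite.of_surjective f hf
    have := Module.Finite.of_surjective (LinearMap.fst R M N) LinearMap.fst_surjective
    have := Module.Finite.of_surjective (LinearMap.snd R M N) LinearMap.snd_surjective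
    obtain ⟨a, f, hf⟩ := Module.Finite.exists_fin' R M
    obtain ⟨b, g, hg⟩ := Module.Finite.exists_fin' R N
    refine ⟨Fin a → R, _, _, inferInstance, inferInstance, f, hf,
      hP.summand (N := LinearMap.ker g) ?_⟩
    refine hP.left_of_exact (A := (Fin a → R) × (Fin b → R))
      (f := (LinearMap.ker f).subtype.prodMap (LinearMap.ker g).subtype) (g := f.prodMap g)
      (Function.Injective.prodMap Subtype.val_injective Subtype.val_injective) ?_
      (Function.Surjective.prodMap hf hg) (hP.prod (hP.pi a) (hP.pi b)) h
    rintro ⟨x, y⟩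
    simp [Prod.ext_iff]
  self := ⟨R, _, _, inferInstance, inferInstance, LinearMap.id, Function.surjective_id, by
    rw [LinearMap.ker_id]; exact hP.of_subsingleton⟩

theorem iterCosyzygy (hP : P.IsSummandStable) (n : ℕ) : (P.iterCosyzygy n).IsSummandStable := by
  induction n with
  | zero => exact hP
  | succ n ih => exact ih.cosyzygy

/-- Since membership in the summand-stable class P is independent of the covers, the covers that
witness Q also serve P. -/
theorem iterCosyzygy_inter {Q : ModuleClass R} (hP : P.IsSummandStable) (n : ℕ) {M : Type u}
    [AddCommGroup M] [Module R M] (h : P.iterCosyzygy n M) (hQ : Q.iterCosyzygy n M) :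
    (P.inter Q).iterCosyzygy n M := by
  induction n generalizing M with
  | zero => exact ⟨h, hQ⟩
  | succ n ih =>
    obtain ⟨F, _, _, _, _, f, hf, hK⟩ := hQ
    exact ⟨F, _, _, ‹_›, ‹_›, f, hf, ih ((hP.iterCosyzygy n).left_of_exact
      (Submodule.subtype_injective _) (LinearMap.exact_subtype_ker_map f) hf
      (hP.iterCosyzygy n).of_projective h) hK⟩

-- From 0 → A → A → A/xA → 0: dividing by a regular element costs one syzygy.
open scoped Pointwise in
theorem iterCosyzygy_quotSMulTop (hP : P.IsSummandStable) {x : R} {j : ℕ} {A : Type u}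
    [AddCommGroup A] [Module R A] (hA : ∀ i, j ≤ i → P.iterCosyzygy i A) (hx : IsSMulRegular A x)
    (i : ℕ) (hi : j + 1 ≤ i) : P.iterCosyzygy i (QuotSMulTop x A) := by
  obtain ⟨i, rfl⟩ : ∃ k, i = k + 1 := ⟨i - 1, by omega⟩
  have hex : Function.Exact (LinearMap.lsmul R A x) (x • (⊤ : Submodule R A)).mkQ :=
    LinearMap.exact_lsmul_mkQ_smul_top A x
  exact (hP.iterCosyzygy i).cosyzygy_of_left_of_middle (f := LinearMap.lsmul R A x) hx hex
    (Submodule.mkQ_surjective _) (hA i (by omega)) (hA (i + 1) (by omega))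

open RingTheory.Sequence in
theorem iterCosyzygy_quotient (hP : P.IsSummandStable) {rs : List R} {j : ℕ} {A : Type u}
    [AddCommGroup A] [Module R A] (hA : ∀ i, j ≤ i → P.iterCosyzygy i A)
    (h : IsWeaklyRegular A rs) :
    P.iterCosyzygy (j + rs.length) (A ⧸ (Ideal.ofList rs • ⊤ : Submodule R A)) := by
  induction rs generalizing j A with
  | nil =>
    refine (hP.iterCosyzygy j).iso (Submodule.quotEquivOfEqBot _ ?_).symm (hA j le_rfl)
    rw [Ideal.ofList_nil, Submodule.bot_smul]
  | cons x rs ih =>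
    rw [isWeaklyRegular_cons_iff] at h
    have := ih (hP.iterCosyzygy_quotSMulTop hA h.1) h.2
    rw [List.length_cons, add_comm rs.length, ← add_assoc]
    exact (hP.iterCosyzygy _).iso
      (Submodule.quotOfListConsSMulTopEquivQuotSMulTopInner A x rs).symm this

end IsSummandStable

end ModuleClass

end ModuleClasses

/-! ### Reduction along a regular sequence, and membership of R. -/

section Factorization

open RingTheory.Sequence CategoryTheory
open scoped Pointwise

variable {R : Type u} [CommRing R] {P : ModuleClass R}

namespace ModuleClass

/-- Suppose that multiplication by each member of a sequence `rs` on `M` factors through a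
module of finite type on which `rs` is regular. If the residue field has its `i`-th syzygies
in `P` for all large enough `i`, then the `j`-th syzygies of `M` are in `P`. -/
theorem IsSummandStable.iterCosyzygy_of_factorization [IsLocalRing R] [IsNoetherianRing R]
    (hP : P.IsSummandStable) {t : ℕ} {rs : List R} {j : ℕ} {M : Type u} [AddCommGroup M]
    [Module R M] [Module.Finite R M]
    (hk : ∀ i, t ≤ i → i ≤ j + rs.length → P.iterCosyzygy i (ResidueField R))
    (ht : t ≤ j + rs.length)
    (hfac : ∀ x ∈ rs, ∃ (B : Type u) (_ : AddCommGroup B) (_ : Module R B),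
      (∀ i, j ≤ i → P.iterCosyzygy i B) ∧ IsWeaklyRegular B rs ∧
      ∃ (α : M →ₗ[R] B) (β : B →ₗ[R] M), Function.Surjective β ∧ ∀ y, β (α y) = x • y)
    {n : ℕ} (hn : maximalIdeal R ^ n ≤ Ideal.ofList rs ⊔ Module.annihilator R M)
    (hM : DepthGE R (t - j) M) : P.iterCosyzygy j M := by
  induction rs generalizing j M with
  -- With the sequence exhausted, a power of 𝔪 kills M, so M is filtered by copies of k.
  | nil =>
    simp only [List.length_nil, add_zero] at ht hk
    refine (hP.iterCosyzygy j).of_pow_smul_eq_zero (hk j ht le_rfl) (n := n) fun r hr y => ?_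
    have := hn hr
    rw [Ideal.ofList_nil, bot_sup_eq] at this
    exact Module.mem_annihilator.1 this y
  | cons x rs ih =>
    let K := LinearMap.ker (LinearMap.lsmul R M x)
    -- For z in the sequence, z y = β (α y). When x y = 0, the element α y is killed by x, which is
    -- regular on B, so α y = 0. Thus the whole sequence kills y.
    have hK : ∀ y : M, x • y = 0 → ∀ r ∈ maximalIdeal R ^ n, r • y = 0 := by
      intro y hy
      suffices h : Ideal.ofList (x :: rs) ⊔ Module.annihilator R M ≤
          LinearMap.ker (LinearMap.toSpanSingleton R M y) from fun r hr => by
        simpa using h (hn hr)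
      refine sup_le (Ideal.span_le.2 fun z hz => ?_) fun z hz => ?_
      · obtain ⟨B, _, _, -, hB, α, β, -, h⟩ := hfac z hz
        rw [isWeaklyRegular_cons_iff] at hB
        have h0 : α y = 0 := hB.1.right_eq_zero_of_smul (by rw [← map_smul, hy, map_zero])
        simp [← h, h0]
      · simpa using Module.mem_annihilator.1 hz y
    have hreg (htj : j < t) : IsSMulRegular M x := by
      refine isSMulRegular_iff_right_eq_zero_of_smul.2 fun y hy => ?_
      exact (hM.mono (m := 1) (by omega)).eq_zero_of_pow_smul (hK y hy)
    -- While j < t positive depth makes K zero; from j = t on, K has finite length and k already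
    -- lies in the j-th class.
    have hPK : P.iterCosyzygy j K := by
      rcases le_or_gt t j with htj | htj
      · refine (hP.iterCosyzygy j).of_pow_smul_eq_zero (hk j htj (by omega)) (n := n)
          fun r hr y => Subtype.ext (hK y.1 ?_ r hr)
        exact y.2
      · have : Subsingleton K := by
          rw [Submodule.subsingleton_iff_eq_bot, ← isSMulRegular_iff_ker_lsmul_eq_bot]
          exact hreg htj
        exact (hP.iterCosyzygy j).of_subsingleton
    -- The induction runs over M/xM with j + 1; the factorizations descend to B/xB, where the
    -- remaining sequence is regular.
    have hquot : P.iterCosyzygy (j + 1) (QuotSMulTop x M) := by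
      rw [List.length_cons] at hk ht
      refine ih (fun i h1 h2 => hk i h1 (by omega)) (by omega) ?_ (hn.trans ?_) ?_
      · intro z hz
        obtain ⟨B, _, _, hB, hBr, α, β, hβ, h⟩ := hfac z (List.mem_cons_of_mem _ hz)
        rw [isWeaklyRegular_cons_iff] at hBr
        refine ⟨QuotSMulTop x B, _, _, hP.iterCosyzygy_quotSMulTop hB hBr.1, hBr.2,
          QuotSMulTop.map x α, QuotSMulTop.map x β, QuotSMulTop.map_surjective x hβ, fun y => ?_⟩
        obtain ⟨y, rfl⟩ := Submodule.Quotient.mk_surjective _ y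
        rw [QuotSMulTop.map_apply_mk, QuotSMulTop.map_apply_mk, h]
        rfl
      · rw [Ideal.ofList_cons]
        have h1 : Ideal.span {x} ≤ Module.annihilator R (QuotSMulTop x M) := by
          rw [Ideal.span_singleton_le_iff_mem]
          exact QuotSMulTop.mem_annihilator M x
        have h2 : Module.annihilator R M ≤ Module.annihilator R (QuotSMulTop x M) :=
          LinearMap.annihilator_le_of_surjective _ (Submodule.mkQ_surjective _)
        exact sup_le (sup_le (h1.trans le_sup_right) le_sup_left) (h2.trans le_sup_right)
      · rcases le_or_gt t j with htj | htj
        · rw [Nat.sub_eq_zero_of_le (by omega)]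
          exact ⟨[], rfl, by simp, .nil R _⟩
        · refine DepthGE.quotSMulTop (hreg htj) ?_
          rwa [show t - (j + 1) + 1 = t - j by omega]
    obtain ⟨B, _, _, hB, -, α, β, hβ, h⟩ := hfac x List.mem_cons_self
    let π : B →ₗ[R] QuotSMulTop x M := (x • (⊤ : Submodule R M)).mkQ ∘ₗ β
    have hker : P.iterCosyzygy j (LinearMap.ker π) :=
      (hP.iterCosyzygy j).left_of_exact (Submodule.subtype_injective _)
        (LinearMap.exact_subtype_ker_map π) ((Submodule.mkQ_surjective _).comp hβ)
        (hB j le_rfl) hquot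
    -- An extension of ker π by K; y ↦ (-α y, y) embeds M in it, with the second projection as
    -- retraction.
    let Q := LinearMap.ker (β.coprod (LinearMap.lsmul R M x))
    have hmem (z : B × M) : z ∈ Q ↔ β z.1 + x • z.2 = 0 := by simp [Q]
    have hQ : P.iterCosyzygy j Q := by
      refine (hP.iterCosyzygy j).extension (L := K) (N := LinearMap.ker π)
        (f := (LinearMap.inr R B M ∘ₗ K.subtype).codRestrict Q fun y => ?_)
        (g := (LinearMap.fst R B M ∘ₗ Q.subtype).codRestrict _ fun z => ?_) ?_ ?_ ?_ hPK hker
      · have : x • (y : M) = 0 := y.2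
        rw [hmem]; simpa using this
      · have := (hmem _).1 z.2
        change Submodule.Quotient.mk (β z.1.1) = 0
        rw [Submodule.Quotient.mk_eq_zero, eq_neg_of_add_eq_zero_left this, neg_mem_iff]
        exact Submodule.smul_mem_pointwise_smul _ _ _ trivial
      · intro y z hyz
        exact Subtype.ext (congrArg (fun w => w.1.2) hyz)
      · rintro ⟨⟨b, y⟩, hby⟩
        constructor
        · intro h0
          obtain rfl : b = 0 := congrArg Subtype.val h0
          have hy : x • y = 0 := by simpa using (hmem _).1 hby
          exact ⟨⟨y, hy⟩, rfl⟩
        · rintro ⟨z, hz⟩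
          exact Subtype.ext (congrArg (fun w => w.1.1) hz).symm
      · rintro ⟨b, hb⟩
        have hb : β b ∈ x • (⊤ : Submodule R M) := by
          rw [← Submodule.Quotient.mk_eq_zero]; exact hb
        obtain ⟨y, -, hy⟩ := (Submodule.mem_smul_pointwise_iff_exists _ _ _).1 hb
        exact ⟨⟨(b, -y), (hmem _).2 (by simp [hy])⟩, rfl⟩
    refine (hP.iterCosyzygy j).of_retract
      (i := ((-α).prod LinearMap.id).codRestrict Q fun y => ?_)
      (p := LinearMap.snd R B M ∘ₗ Q.subtype) (fun y => rfl) hQ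
    rw [hmem]
    simp [h]

/-- The class of finite projective modules. -/
def finiteProjective (R : Type u) [CommRing R] : ModuleClass R :=
  fun M _ _ => Module.Finite R M ∧ Module.Projective R M

theorem isSummandStable_finiteProjective : (finiteProjective R).IsSummandStable where
  zero := ⟨inferInstance, inferInstance⟩
  iso e := fun ⟨_, _⟩ => ⟨Module.Finite.equiv e, Module.Projective.of_equiv e⟩
  extension {L M N} _ _ _ _ _ _ f g hf hfg hg := by
    rintro ⟨_, _⟩ ⟨_, _⟩
    obtain ⟨s, hs⟩ := Module.projective_lifting_property g LinearMap.id hg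
    obtain ⟨e⟩ := nonempty_linearEquiv_prod_of_retract (LinearMap.congr_fun hs)
    let e' : L ≃ₗ[R] LinearMap.ker g :=
      LinearEquiv.ofInjective f hf ≪≫ₗ LinearEquiv.ofEq _ _ hfg.linearMap_ker_eq.symm
    have := Module.Finite.equiv e'
    have := Module.Projective.of_equiv e'
    exact ⟨Module.Finite.equiv e.symm, Module.Projective.of_equiv e.symm⟩
  finite h := h.1
  summand {M N} _ _ _ _ := fun ⟨_, _⟩ =>
    ⟨Module.Finite.of_surjective (LinearMap.fst R M N) LinearMap.fst_surjective,
      Module.Projective.of_split (LinearMap.inl R M N) (LinearMap.fst R M N) (by ext; rfl)⟩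
  self := ⟨inferInstance, inferInstance⟩

/-- Here P consists of zero modules only, so a vanishing n-th syzygy bounds the projective
dimension. -/
theorem hasProjectiveDimensionLT_of_iterCosyzygy
    (hP : ∀ (M : Type u) [AddCommGroup M] [Module R M], P M → Subsingleton M) {n : ℕ} {M : Type u}
    [AddCommGroup M] [Module R M] (h : P.iterCosyzygy n M) :
    HasProjectiveDimensionLT (ModuleCat.of R M) n := by
  induction n generalizing M with
  | zero =>
    have := hP M h
    exact (ModuleCat.isZero_of_subsingleton _).hasProjectiveDimensionLT_zero
  | succ n ih =>
    obtain ⟨F, _, _, _, _, f, hf, hK⟩ := h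
    have hS := ModuleCat.shortExact_of_linearMap (Submodule.subtype_injective (LinearMap.ker f))
      (LinearMap.exact_subtype_ker_map f) hf
    have : Projective (ModuleCat.of R F) := (IsProjective.iff_projective _).1 ‹_›
    have hF := projective_iff_hasProjectiveDimensionLT_one.1 this
    exact hS.hasProjectiveDimensionLT_X₃ n (ih hK)
      (hasProjectiveDimensionLT_of_ge _ 1 (n + 1) (by omega))

end ModuleClass

variable [IsLocalRing R] [IsNoetherianRing R]

theorem exists_maximalIdeal_pow_le {I : Ideal R}
    (h : ∀ p : Ideal R, p.IsPrime → I ≤ p → p = maximalIdeal R) :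
    ∃ n, maximalIdeal R ^ n ≤ I := by
  refine Ideal.exists_pow_le_of_le_radical_of_fg ?_ (IsNoetherian.noetherian _)
  rw [Ideal.radical_eq_sInf]
  exact le_sInf fun p hp => (h p hp.2 hp.1).ge

theorem exists_maximalIdeal_pow_le_ofList {rs : List R} (hm : ∀ r ∈ rs, r ∈ maximalIdeal R)
    (hrs : IsWeaklyRegular R rs) (hd : ringKrullDim R = rs.length) :
    ∃ n, maximalIdeal R ^ n ≤ Ideal.ofList rs := by
  have hreg : IsRegular R rs :=
    (IsLocalRing.isRegular_iff_isWeaklyRegular_of_subset_maximalIdeal hm).2 hrs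
  have h := ringKrullDim_add_length_eq_ringKrullDim_of_isRegular rs hreg
  have h0 : ringKrullDim (R ⧸ Ideal.ofList rs) ≤ 0 := by
    rw [hd] at h
    generalize ringKrullDim (R ⧸ Ideal.ofList rs) = a at h
    cases a with
    | bot => exact bot_le
    | coe a =>
      cases a with
      | top =>
        have h : (⊤ : ℕ∞) + rs.length = rs.length := by exact_mod_cast h
        rw [top_add] at h
        exact absurd h (ENat.top_ne_natCast _)
      | coe a =>
        have : a + rs.length = rs.length := by exact_mod_cast h
        have : a = 0 := by omega
        simp [this]
  have : Ring.KrullDimLE 0 (R ⧸ Ideal.ofList rs) :=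
    (Ring.krullDimLE_iff).2 (by exact_mod_cast h0)
  refine exists_maximalIdeal_pow_le fun p hp hle => ?_
  have hp' : (p.map (Ideal.Quotient.mk (Ideal.ofList rs))).IsPrime :=
    Ideal.map_isPrime_of_surjective Ideal.Quotient.mk_surjective (by rwa [Ideal.mk_ker])
  have hmax : (p.map (Ideal.Quotient.mk (Ideal.ofList rs))).IsMaximal :=
    Ideal.isMaximal_of_isPrime _
  have := Ideal.comap_isMaximal_of_surjective (Ideal.Quotient.mk (Ideal.ofList rs))
    Ideal.Quotient.mk_surjective (K := p.map (Ideal.Quotient.mk (Ideal.ofList rs)))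
  rw [Ideal.comap_map_of_surjective _ Ideal.Quotient.mk_surjective, ← RingHom.ker_eq_comap_bot,
    Ideal.mk_ker, sup_eq_left.2 hle] at this
  exact IsLocalRing.eq_maximalIdeal this

/-- Over a Cohen-Macaulay local ring of dimension `d`, an extension-stable class of modules
closed under direct summands contains `R` if it contains a `d`-th syzygy of the residue field. -/
theorem ModuleClass.IsExtensionStable.self_of_residueField (hP : P.IsExtensionStable)
    (hsum : ∀ {M N : Type u} [AddCommGroup M] [Module R M] [AddCommGroup N] [Module R N],
      P (M × N) → P M) {d : ℕ} (hd : ringKrullDim R = d) (hR : DepthGE R d R)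
    (hk : P.iterCosyzygy d (ResidueField R)) : P R := by
  obtain ⟨rs, rfl, hm, hrs⟩ := hR
  obtain ⟨n, hn⟩ := exists_maximalIdeal_pow_le_ofList hm hrs hd
  -- A has finite length, hence a d-th syzygy in P; it also has a finite projective one, and both
  -- properties can be realized by the same syzygy.
  let A := R ⧸ (Ideal.ofList rs • ⊤ : Submodule R R)
  have hA : P.iterCosyzygy rs.length A := by
    refine (hP.iterCosyzygy _).of_pow_smul_eq_zero hk (n := n) fun r hr y => ?_
    obtain ⟨y, rfl⟩ := Submodule.Quotient.mk_surjective _ y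
    rw [← Submodule.Quotient.mk_smul, Submodule.Quotient.mk_eq_zero]
    exact Submodule.smul_mem_smul (hn hr) trivial
  have hA' : (ModuleClass.finiteProjective R).iterCosyzygy rs.length A := by
    have hs := ModuleClass.isSummandStable_finiteProjective (R := R)
    have := hs.iterCosyzygy_quotient (j := 0) (fun i _ => (hs.iterCosyzygy i).self) hrs
    rwa [zero_add] at this
  -- If R ∉ P, a nonzero finite projective module cannot lie in P, since it is free and has R as a
  -- summand. The common d-th syzygy then vanishes, contradicting that A has projective dimension d.
  by_contra hPR
  have hlt := ModuleClass.hasProjectiveDimensionLT_of_iterCosyzygy ?_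
    (ModuleClass.isSummandStable_finiteProjective.iterCosyzygy_inter _ hA' hA)
  · have h1 := ModuleCat.projectiveDimension_quotient_eq_add_length_of_isWeaklyRegular
      (ModuleCat.of R R) rs hrs hm
    have h0 : projectiveDimension (ModuleCat.of R R) = 0 :=
      ModuleCat.projectiveDimension_eq_zero_of_projective _
    rw [h0, zero_add] at h1
    have h2 := projectiveDimension_lt_iff.2 hlt
    exact absurd h2 (by rw [← h1]; exact lt_irrefl _)
  · rintro M _ _ ⟨⟨_, _⟩, hM⟩
    by_contra hns
    rw [not_subsingleton_iff_nontrivial] at hns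
    have : Module.Free R M := Module.free_of_flat_of_isLocalRing
    let b := Module.Free.chooseBasis R M
    obtain ⟨i⟩ := b.index_nonempty
    obtain ⟨e⟩ := ModuleClass.nonempty_linearEquiv_prod_of_retract
      (i := LinearMap.toSpanSingleton R M (b i)) (p := b.coord i) (fun y => by simp)
    exact hPR (hsum (hP.iso e hM))

end Factorization

/-! ### Multiplications factoring through projectives. -/

section StableAnnihilator

open RingTheory.Sequence

variable {R : Type u} [CommRing R]

/-- The ideal of ring elements multiplication by which on `M` factors through a finite projective
module. -/
def stableAnnihilator (R : Type u) [CommRing R] (M : Type u) [AddCommGroup M] [Module R M] :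
    Ideal R where
  carrier := {r | ∃ (F : Type u) (_ : AddCommGroup F) (_ : Module R F) (_ : Module.Finite R F)
    (_ : Module.Projective R F) (α : M →ₗ[R] F) (β : F →ₗ[R] M), ∀ y, β (α y) = r • y}
  add_mem' := by
    rintro r s ⟨F, _, _, _, _, α, β, h⟩ ⟨G, _, _, _, _, γ, δ, h'⟩
    exact ⟨F × G, _, _, inferInstance, inferInstance, α.prod γ, β.coprod δ, fun y => by
      simp [h, h', add_smul]⟩
  zero_mem' := ⟨PUnit, _, _, inferInstance, inferInstance, 0, 0, fun y => by simp⟩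
  smul_mem' := by
    rintro c r ⟨F, _, _, _, _, α, β, h⟩
    exact ⟨F, _, _, ‹_›, ‹_›, α, c • β, fun y => by simp [h, mul_smul]⟩

/-- Adding a free cover of M to F, with zero component in α, makes β surjective without changing β ∘
α. -/
theorem exists_surjective_of_mem_stableAnnihilator {M : Type u} [AddCommGroup M] [Module R M]
    [Module.Finite R M] {r : R} (hr : r ∈ stableAnnihilator R M) :
    ∃ (F : Type u) (_ : AddCommGroup F) (_ : Module R F) (_ : Module.Finite R F)
      (_ : Module.Projective R F) (α : M →ₗ[R] F) (β : F →ₗ[R] M), Function.Surjective β ∧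
        ∀ y, β (α y) = r • y := by
  obtain ⟨F, _, _, _, _, α, β, h⟩ := hr
  obtain ⟨n, g, hg⟩ := Module.Finite.exists_fin' R M
  refine ⟨F × (Fin n → R), _, _, inferInstance, inferInstance, α.prod 0, β.coprod g, fun y => ?_,
    fun y => by simp [h]⟩
  obtain ⟨x, rfl⟩ := hg y
  exact ⟨(0, x), by simp⟩

/-- An isomorphism of M_p with a free module and its inverse both lift to R after clearing
denominators, by finite presentation; the composite on M is multiplication by an element outside p.
-/
theorem exists_mem_stableAnnihilator_of_free_localizedModule [IsNoetherianRing R] {M : Type u}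
    [AddCommGroup M] [Module R M] [Module.Finite R M] (p : Ideal R) [p.IsPrime]
    [hfree : Module.Free (Localization.AtPrime p) (LocalizedModule p.primeCompl M)] :
    ∃ s ∈ stableAnnihilator R M, s ∉ p := by
  let S := Localization.AtPrime p
  let f := LocalizedModule.mkLinearMap p.primeCompl M
  have : Module.Finite S (LocalizedModule p.primeCompl M) :=
    Module.Finite.of_isLocalizedModule p.primeCompl f
  let b := Module.Free.chooseBasis S (LocalizedModule p.primeCompl M)
  let ι := Module.Free.ChooseBasisIndex S (LocalizedModule p.primeCompl M)
  let g : (ι → R) →ₗ[R] (ι → S) := .pi fun i => Algebra.linearMap R S ∘ₗ .proj i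
  have hg : IsLocalizedModule p.primeCompl g := inferInstance
  let e : LocalizedModule p.primeCompl M ≃ₗ[R] (ι → S) := b.equivFun.restrictScalars R
  have : Module.FinitePresentation R M := Module.finitePresentation_of_finite R M
  obtain ⟨α, s, hα⟩ := Module.FinitePresentation.exists_lift_of_isLocalizedModule p.primeCompl g
    (e.toLinearMap ∘ₗ f)
  have : Module.FinitePresentation R (ι → R) := Module.finitePresentation_of_finite R _
  obtain ⟨β, t, hβ⟩ := Module.FinitePresentation.exists_lift_of_isLocalizedModule p.primeCompl f
    (e.symm.toLinearMap ∘ₗ g)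
  have hcomp : f ∘ₗ (β ∘ₗ α) = f ∘ₗ ((t * s) • LinearMap.id) := by
    ext y
    have h1 := LinearMap.congr_fun hα y
    have h2 := LinearMap.congr_fun hβ (α y)
    simp only [LinearMap.comp_apply, LinearMap.smul_apply, LinearEquiv.coe_coe,
      LinearMap.id_apply, LinearMap.map_smul_of_tower] at h1 h2 ⊢
    rw [h2, h1, Submonoid.smul_def s, map_smul, LinearEquiv.symm_apply_apply, mul_smul]
    rfl
  obtain ⟨u, hu⟩ := Module.Finite.exists_smul_of_comp_eq_of_isLocalizedModule
    p.primeCompl f _ _ hcomp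
  refine ⟨((u * (t * s) : p.primeCompl) : R), ?_, (u * (t * s)).2⟩
  have : Fintype ι := inferInstance
  let e' : (ι → R) ≃ₗ[R] (Fin (Fintype.card ι) → R) :=
    LinearEquiv.funCongrLeft R R (Fintype.equivFin ι).symm
  refine ⟨Fin (Fintype.card ι) → R, _, _, inferInstance, inferInstance, e'.toLinearMap ∘ₗ α,
    ((u : R) • β) ∘ₗ e'.symm.toLinearMap, fun y => ?_⟩
  have := LinearMap.congr_fun hu y
  simp only [LinearMap.comp_apply, LinearMap.smul_apply, LinearEquiv.coe_coe,
    LinearEquiv.symm_apply_apply, LinearMap.id_apply] at this ⊢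
  rw [Submonoid.coe_mul, mul_smul]
  exact this

theorem isWeaklyRegular_of_projective {F : Type u} [AddCommGroup F] [Module R F]
    [Module.Projective R F] {rs : List R} (h : IsWeaklyRegular R rs) : IsWeaklyRegular F rs :=
  ((TensorProduct.rid R F).isWeaklyRegular_congr rs).1 (h.isWeaklyRegular_lTensor (M₂ := F))

variable [IsLocalRing R] [IsNoetherianRing R]

theorem IsFreeOnPuncturedSpectrum.exists_pow_le_stableAnnihilator {M : Type u} [AddCommGroup M]
    [Module R M] [Module.Finite R M] (h : IsFreeOnPuncturedSpectrum R M) :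
    ∃ n, maximalIdeal R ^ n ≤ stableAnnihilator R M := by
  refine exists_maximalIdeal_pow_le fun p hp hle => ?_
  by_contra hne
  have := h p hne
  obtain ⟨s, hs, hsp⟩ := exists_mem_stableAnnihilator_of_free_localizedModule (M := M) p
  exact hsp (hle hs)

/-- A module of depth at least `t` that is free on the punctured spectrum belongs to every
extension-stable class of finite modules closed under direct summands that contains the `i`-th
syzygies of the residue field for `t ≤ i ≤ d`. -/
theorem ModuleClass.IsSummandStable.of_isFreeOnPuncturedSpectrum {P : ModuleClass R}
    (hP : P.IsSummandStable) {d t : ℕ} (hd : ringKrullDim R = d) (hR : DepthGE R d R) (ht : t ≤ d)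
    (hk : ∀ i, t ≤ i → i ≤ d → P.iterCosyzygy i (ResidueField R)) {M : Type u} [AddCommGroup M]
    [Module R M] [Module.Finite R M] (hM : DepthGE R t M) (hfree : IsFreeOnPuncturedSpectrum R M) :
    P M := by
  obtain ⟨N, hN⟩ := hfree.exists_pow_le_stableAnnihilator
  -- The regular sequence is chosen inside the stable annihilator. The exponent N + 1 is positive,
  -- so the power also lies in 𝔪 when N = 0.
  obtain ⟨rs, rfl, hmem, hrs⟩ := hR.exists_isWeaklyRegular_of_pow_le
    (I := stableAnnihilator R M ⊓ maximalIdeal R) (N := N + 1) inf_le_right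
    (le_inf ((Ideal.pow_le_pow_right (Nat.le_succ N)).trans hN)
      (Ideal.pow_le_self (Nat.succ_ne_zero N)))
  obtain ⟨n, hn⟩ := exists_maximalIdeal_pow_le_ofList (fun r hr => (hmem r hr).2) hrs hd
  refine hP.iterCosyzygy_of_factorization (rs := rs) (j := 0) (t := t) (by simpa using hk)
    (by simpa using ht) (fun x hx => ?_) (hn.trans le_sup_left) hM
  obtain ⟨F, _, _, _, _, α, β, hβ, h⟩ := exists_surjective_of_mem_stableAnnihilator (hmem x hx).1
  exact ⟨F, _, _, fun i _ => (hP.iterCosyzygy i).of_projective, isWeaklyRegular_of_projective hrs,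
    α, β, hβ, h⟩

end StableAnnihilator

/-! ### Maximal Cohen–Macaulay modules over regular rings and their localizations. -/

section MaximalCohenMacaulay

open RingTheory.Sequence
open scoped Pointwise

variable {R : Type u} [CommRing R]

/-- Regularity on M keeps K → F injective modulo the sequence, where by `hK` it is also zero;
Nakayama then gives K = 0. -/
theorem subsingleton_of_exact_of_isWeaklyRegular [IsLocalRing R] [IsNoetherianRing R] {rs : List R}
    (hm : ∀ r ∈ rs, r ∈ maximalIdeal R) {K F M : Type u} [AddCommGroup K] [Module R K]
    [Module.Finite R K] [AddCommGroup F] [Module R F] [AddCommGroup M] [Module R M]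
    {f : K →ₗ[R] F} {g : F →ₗ[R] M} (hf : Function.Injective f) (hfg : Function.Exact f g)
    (hg : Function.Surjective g) (hrs : IsWeaklyRegular M rs)
    (hK : ∀ y, f y ∈ (Ideal.ofList rs • ⊤ : Submodule R F)) : Subsingleton K := by
  induction rs generalizing K F M with
  | nil =>
    refine ⟨fun a b => hf ?_⟩
    have h (y : K) : f y = 0 := by simpa [Ideal.ofList_nil] using hK y
    rw [h, h]
  | cons x rs ih =>
    rw [isWeaklyRegular_cons_iff] at hrs
    have hexact : Function.Exact (0 : K →ₗ[R] K) f := fun y => by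
      simp [map_eq_zero_iff f hf, eq_comm]
    have hinj : Function.Injective (QuotSMulTop.map x f) := by
      have := QuotSMulTop.map_first_exact_on_four_term_exact_of_isSMulRegular_last hexact hfg hrs.1
      rw [injective_iff_map_eq_zero]
      intro y hy
      obtain ⟨z, rfl⟩ := (this y).1 hy
      obtain ⟨w, rfl⟩ := Submodule.Quotient.mk_surjective _ z
      rfl
    have hsub : Subsingleton (QuotSMulTop x K) := by
      refine ih (fun r hr => hm r (List.mem_cons_of_mem _ hr)) hinj (QuotSMulTop.map_exact x hfg hg)
        (QuotSMulTop.map_surjective x hg) hrs.2 fun y => ?_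
      obtain ⟨y, rfl⟩ := Submodule.Quotient.mk_surjective _ y
      have h := hK y
      rw [Ideal.ofList_cons_smul] at h
      obtain ⟨a, ha, b, hb, hab⟩ := Submodule.mem_sup.1 h
      rw [QuotSMulTop.map_apply_mk, ← hab, Submodule.Quotient.mk_add,
        (Submodule.Quotient.mk_eq_zero _).2 ha, zero_add]
      have := Submodule.mem_map_of_mem (f := (x • (⊤ : Submodule R F)).mkQ) hb
      rw [Submodule.map_smul''] at this
      exact Submodule.smul_mono le_rfl le_top this
    by_contra hns
    rw [not_subsingleton_iff_nontrivial] at hns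
    have := nontrivial_quotSMulTop_of_mem_maximalIdeal K (hm x List.mem_cons_self)
    exact not_subsingleton _ hsub

/-- Krull's height theorem in R/q: the images of the sequence generate an ideal over which the
maximal ideal is minimal. -/
theorem ringKrullDim_quotient_le_length [IsLocalRing R] [IsNoetherianRing R] {q : Ideal R}
    (hq : q.IsPrime) {rs : List R} (hm : ∀ r ∈ rs, r ∈ maximalIdeal R)
    (h : ∀ p : Ideal R, p.IsPrime → q ⊔ Ideal.ofList rs ≤ p → p = maximalIdeal R) :
    ringKrullDim (R ⧸ q) ≤ rs.length := by
  classical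
  have : Nontrivial (R ⧸ q) := Ideal.Quotient.nontrivial_iff.2 hq.ne_top
  have : IsLocalRing (R ⧸ q) :=
    IsLocalRing.of_surjective' (Ideal.Quotient.mk q) Ideal.Quotient.mk_surjective
  let s := rs.toFinset.image (Ideal.Quotient.mk q)
  have hmin : maximalIdeal (R ⧸ q) ∈ (Ideal.span (s : Set (R ⧸ q))).minimalPrimes := by
    refine ⟨⟨inferInstance, le_maximalIdeal fun htop => ?_⟩, fun p ⟨hp, hle⟩ _ => ?_⟩
    · have hle : Ideal.span (s : Set (R ⧸ q)) ≤ (maximalIdeal R).map (Ideal.Quotient.mk q) := by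
        refine Ideal.span_le.2 fun x hx => ?_
        obtain ⟨r, hr, rfl⟩ := Finset.mem_image.1 (Finset.mem_coe.1 hx)
        exact Ideal.mem_map_of_mem _ (hm r (List.mem_toFinset.1 hr))
      rw [htop, top_le_iff] at hle
      refine (maximalIdeal.isMaximal R).ne_top ?_
      rw [← Ideal.comap_map_mk (le_maximalIdeal hq.ne_top), hle, Ideal.comap_top]
    · have := h (p.comap (Ideal.Quotient.mk q)) inferInstance <| sup_le
        (fun x hx => by
          rw [Ideal.mem_comap, Ideal.Quotient.eq_zero_iff_mem.2 hx]; exact p.zero_mem)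
        (Ideal.span_le.2 fun x hx => hle (Ideal.subset_span
          (Finset.mem_coe.2 (Finset.mem_image_of_mem _ (List.mem_toFinset.2 hx)))))
      intro x hx
      obtain ⟨x, rfl⟩ := Ideal.Quotient.mk_surjective x
      rw [← Ideal.mem_comap, this]
      rw [mem_maximalIdeal, mem_nonunits_iff] at hx ⊢
      exact fun hu => hx (hu.map _)
  rw [← maximalIdeal_height_eq_ringKrullDim]
  have h1 := Ideal.height_le_card_of_mem_minimalPrimes_span_finset hmin
  have h2 : s.card ≤ rs.length := Finset.card_image_le.trans rs.toFinset_card_le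
  exact_mod_cast h1.trans (by exact_mod_cast h2)

/-- A system of parameters on a module of maximal depth is a regular sequence. -/
theorem DepthGE.isWeaklyRegular [IsLocalRing R] [IsNoetherianRing R] {rs : List R}
    (hm : ∀ r ∈ rs, r ∈ maximalIdeal R) {M : Type u} [AddCommGroup M] [Module R M]
    [Module.Finite R M] (hM : DepthGE R rs.length M)
    (h : ∀ p : Ideal R, p.IsPrime → Module.annihilator R M ⊔ Ideal.ofList rs ≤ p →
      p = maximalIdeal R) : IsWeaklyRegular M rs := by
  induction rs generalizing M with
  | nil => exact .nil R M
  | cons x rs ih =>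
    have hm' : ∀ r ∈ rs, r ∈ maximalIdeal R := fun r hr => hm r (List.mem_cons_of_mem _ hr)
    -- A zero divisor x lies in an associated prime q. Then `rs` alone cuts R/q down to dimension
    -- zero, so dim R/q is at most its length, below the depth of M.
    have hx : IsSMulRegular M x := by
      by_contra hx
      have hx : x ∈ ⋃ p ∈ associatedPrimes R M, (p : Set R) := by
        rw [biUnion_associatedPrimes_eq_compl_regular]; exact hx
      obtain ⟨q, hq, hxq⟩ := Set.mem_iUnion₂.1 hx
      have h1 := hM.le_ringKrullDim_quotient hq
      have h2 := ringKrullDim_quotient_le_length hq.isPrime hm' fun p hp hle => h p hp <| by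
        rw [Ideal.ofList_cons]
        exact sup_le ((Submodule.annihilator_top (R := R) (M := M) ▸ hq.annihilator_le).trans (le_sup_left.trans hle))
          (sup_le ((Ideal.span_singleton_le_iff_mem _).2 (hle (Ideal.mem_sup_left hxq)))
            (le_sup_right.trans hle))
      have h3 := h1.trans h2
      rw [List.length_cons] at h3
      have : rs.length + 1 ≤ rs.length := by exact_mod_cast h3
      omega
    refine .cons hx (ih hm' (hM.quotSMulTop hx) fun p hp hle => h p hp ?_)
    have h1 : Ideal.span {x} ≤ Module.annihilator R (QuotSMulTop x M) := by
      rw [Ideal.span_singleton_le_iff_mem]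
      exact QuotSMulTop.mem_annihilator M x
    have h2 : Module.annihilator R M ≤ Module.annihilator R (QuotSMulTop x M) :=
      LinearMap.annihilator_le_of_surjective _ (Submodule.mkQ_surjective _)
    rw [Ideal.ofList_cons]
    exact sup_le (h2.trans (le_sup_left.trans hle))
      (sup_le (h1.trans (le_sup_left.trans hle)) (le_sup_right.trans hle))

/-- Maximal Cohen-Macaulay modules over regular local rings are free. -/
theorem DepthGE.free_of_isRegularLocalRing [IsRegularLocalRing R] {n : ℕ}
    (hn : ringKrullDim R = n) {M : Type u} [AddCommGroup M] [Module R M] [Module.Finite R M]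
    (hM : DepthGE R n M) : Module.Free R M := by
  have hfg : Submodule.FG (maximalIdeal R) := IsNoetherian.noetherian _
  have hspan : Submodule.span R (Submodule.generators (maximalIdeal R)) = maximalIdeal R :=
    (maximalIdeal R).span_generators
  have hfin := Submodule.FG.finite_generators hfg
  let rs := hfin.toFinset.toList
  have hmem (r : R) : r ∈ rs ↔ r ∈ Submodule.generators (maximalIdeal R) := by simp [rs]
  have hrs : Ideal.ofList rs = maximalIdeal R := by
    have : {r | r ∈ rs} = Submodule.generators (maximalIdeal R) := Set.ext hmem
    rw [Ideal.ofList, this]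
    exact hspan
  have hlen : rs.length = n := by
    have h1 := IsRegularLocalRing.spanFinrank_maximalIdeal (R := R)
    rw [hn] at h1
    have h1 : (maximalIdeal R).spanFinrank = n := by exact_mod_cast h1
    rw [← h1, ← Submodule.FG.generators_ncard hfg, Set.ncard_eq_toFinset_card _ hfin, Finset.length_toList]
  have hm : ∀ r ∈ rs, r ∈ maximalIdeal R := fun r hr => by
    rw [← hrs]; exact Ideal.subset_span hr
  have hreg : IsWeaklyRegular M rs := by
    -- A minimal generating set of 𝔪 has dim R elements, so it is a system of parameters, regular on
    -- M.
    refine DepthGE.isWeaklyRegular hm (by rwa [hlen]) fun p hp hle => ?_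
    rw [hrs] at hle
    exact le_antisymm (le_maximalIdeal hp.ne_top) (le_sup_right.trans hle)
  obtain ⟨m, f, hf, hK⟩ := exists_minimal_cover R M
  have hsub : Subsingleton (LinearMap.ker f) := by
    refine subsingleton_of_exact_of_isWeaklyRegular hm (Submodule.subtype_injective _)
      (LinearMap.exact_subtype_ker_map f) hf hreg fun y => ?_
    have hy := hK y y.2
    rw [hrs, Submodule.subtype_apply, pi_eq_sum_univ (y : Fin m → R)]
    exact Submodule.sum_mem _ fun i _ => Submodule.smul_mem_smul (hy i) trivial
  have hinj : Function.Injective f := by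
    rw [← LinearMap.ker_eq_bot, ← Submodule.subsingleton_iff_eq_bot]
    exact hsub
  exact Module.Free.of_equiv (LinearEquiv.ofBijective f ⟨hinj, hf⟩)

theorem height_add_ringKrullDim_quotient_le (p : Ideal R) [hp : p.IsPrime] :
    (p.height : WithBot ℕ∞) + ringKrullDim (R ⧸ p) ≤ ringKrullDim R := by
  let x : PrimeSpectrum R := ⟨p, hp⟩
  have : Nonempty (PrimeSpectrum R) := ⟨x⟩
  have hset : PrimeSpectrum.zeroLocus (p : Set R) = Set.Ici x := rfl
  rw [ringKrullDim_quotient, hset, ← Order.coheight_eq_krullDim_Ici,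
    show p.height = Order.height x from PrimeSpectrum.height_eq_orderHeight x, ringKrullDim,
    Order.krullDim_eq_iSup_height_add_coheight_of_nonempty]
  exact_mod_cast le_iSup (fun a : PrimeSpectrum R => Order.height a + Order.coheight a) x

/-- If p has no M-regular element, then Hom(R/p, M) ≠ 0 and some associated prime of M contains p,
so depth M ≤ dim R/p. Hence elements of p can be split off while the depth exceeds dim R/p. -/
theorem DepthGE.exists_isWeaklyRegular_mem [IsLocalRing R] [IsNoetherianRing R] (p : Ideal R)
    [hp : p.IsPrime] {n m : ℕ} (hn : (n : WithBot ℕ∞) + ringKrullDim (R ⧸ p) ≤ m) {M : Type u}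
    [AddCommGroup M] [Module R M] [Module.Finite R M] (hM : DepthGE R m M) :
    ∃ rs : List R, rs.length = n ∧ (∀ r ∈ rs, r ∈ p) ∧ IsWeaklyRegular M rs := by
  induction n generalizing m M with
  | zero => exact ⟨[], rfl, by simp, .nil R M⟩
  | succ n ih =>
    have : Nontrivial (R ⧸ p) := Ideal.Quotient.nontrivial_iff.2 hp.ne_top
    obtain ⟨a, ha⟩ : ∃ a : ℕ, ringKrullDim (R ⧸ p) = a := by
      have h0 := ringKrullDim_nonneg_of_nontrivial (R := R ⧸ p)
      generalize ringKrullDim (R ⧸ p) = b at *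
      cases b with
      | bot => simp at h0
      | coe b =>
        cases b with
        | top =>
          have hn : ((n + 1 : ℕ) : ℕ∞) + ⊤ ≤ (m : ℕ∞) := by exact_mod_cast hn
          rw [add_top, top_le_iff] at hn
          exact absurd hn (ENat.natCast_ne_top m)
        | coe a => exact ⟨a, rfl⟩
    rw [ha] at hn ih
    have hn : n + 1 + a ≤ m := by exact_mod_cast hn
    obtain ⟨m, rfl⟩ : ∃ k, m = k + 1 := ⟨m - 1, by omega⟩
    have hex : ∃ x ∈ p, IsSMulRegular M x := by
      have key := IsSMulRegular.subsingleton_linearMap_iff (R := R) (N := R ⧸ p) (M := M)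
      rw [Ideal.annihilator_quotient] at key
      refine key.1 ?_
      by_contra hns
      rw [not_subsingleton_iff_nontrivial] at hns
      obtain ⟨φ, hφ⟩ := exists_ne (0 : (R ⧸ p) →ₗ[R] M)
      have h1 : φ 1 ≠ 0 := fun h0 => hφ <| LinearMap.ext fun y => by
        obtain ⟨y, rfl⟩ := Ideal.Quotient.mk_surjective y
        have : Ideal.Quotient.mk p y = y • 1 := by simp [Algebra.smul_def]
        rw [this, map_smul, h0, smul_zero, map_smul, LinearMap.zero_apply, smul_zero]
      obtain ⟨q, hq, hle⟩ := exists_le_isAssociatedPrime_of_isNoetherianRing R (φ 1) h1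
      have hpq : p ≤ q := fun r hr => hle <| by
        have : r • (1 : R ⧸ p) = 0 := by
          simpa [Algebra.smul_def] using Ideal.Quotient.eq_zero_iff_mem.2 hr
        simp [← map_smul, this]
      have h2 := (hM.le_ringKrullDim_quotient hq).trans
        (ringKrullDim_le_of_surjective (Ideal.Quotient.factor hpq)
          (Ideal.Quotient.factor_surjective hpq))
      rw [ha] at h2
      have : m + 1 ≤ a := by exact_mod_cast h2
      omega
    obtain ⟨x, hxp, hx⟩ := hex
    obtain ⟨rs, hl, hmem, hrs⟩ := ih (m := m) (by exact_mod_cast (by omega : n + a ≤ m))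
      (hM.quotSMulTop hx)
    exact ⟨x :: rs, by simp [hl], by simpa using ⟨hxp, hmem⟩, .cons hx hrs⟩

theorem HasIsolatedSingularity.isFreeOnPuncturedSpectrum [IsLocalRing R] [IsNoetherianRing R]
    (h : HasIsolatedSingularity R) {d : ℕ}
    (hd : ringKrullDim R = d) {M : Type u} [AddCommGroup M] [Module R M] [Module.Finite R M]
    (hM : DepthGE R d M) : IsFreeOnPuncturedSpectrum R M := by
  intro p _ hp
  have := h p hp
  have hheight : p.height ≠ ⊤ := Ideal.height_ne_top_of_isPrime
  obtain ⟨n, hn⟩ := ENat.ne_top_iff_exists.1 hheight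
  -- With n = height p, the bound ht p + dim R/p ≤ d gives a sequence in p whose length is dim R_p;
  -- it stays weakly regular after localization.
  obtain ⟨rs, hl, hmem, hrs⟩ := hM.exists_isWeaklyRegular_mem p (n := n) <| by
    rw [← hd]
    refine le_trans (le_of_eq ?_) (height_add_ringKrullDim_quotient_le p)
    rw [← hn]
    rfl
  have hdim : ringKrullDim (Localization.AtPrime p) = n := by
    rw [IsLocalization.AtPrime.ringKrullDim_eq_height p (Localization.AtPrime p), ← hn]
    rfl
  have : Module.Finite (Localization.AtPrime p) (LocalizedModule p.primeCompl M) :=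
    Module.Finite.of_isLocalizedModule p.primeCompl (LocalizedModule.mkLinearMap p.primeCompl M)
  refine DepthGE.free_of_isRegularLocalRing hdim
    ⟨rs.map (algebraMap R (Localization.AtPrime p)), by simpa using hl, ?_,
      hrs.of_isLocalizedModule (Localization.AtPrime p) p.primeCompl
        (LocalizedModule.mkLinearMap p.primeCompl M)⟩
  intro r hr
  obtain ⟨r, hr', rfl⟩ := List.mem_map.1 hr
  rw [← Localization.AtPrime.map_eq_maximalIdeal]
  exact Ideal.mem_map_of_mem _ (hmem r hr')

end MaximalCohenMacaulay

/-! ### From module classes back to extension-closed subcategories. -/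

section ExtensionClosure

variable {R : Type u} [CommRing R]

/-- The class of modules isomorphic to an object of a set of finite modules. -/
def ModuleClass.ofSet (𝒳 : Set (FGModuleCat.{u} R)) : ModuleClass R :=
  fun M _ _ => ∃ _ : Module.Finite R M, FGModuleCat.of R M ∈ 𝒳

theorem IsExtensionClosed.isExtensionStable {𝒳 : Set (FGModuleCat.{u} R)}
    (h : IsExtensionClosed R 𝒳) {X : FGModuleCat.{u} R} (hX : X ∈ 𝒳) :
    (ModuleClass.ofSet 𝒳).IsExtensionStable where
  -- Zero is a summand of any X ∈ 𝒳, so nonemptiness of 𝒳 is needed.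
  zero := ⟨inferInstance, h.summand X (FGModuleCat.of R PUnit) X hX
    ⟨(LinearEquiv.prodUnique (R := R) (M := X) (M₂ := PUnit.{u + 1})).symm ≪≫ₗ
      LinearEquiv.prodComm R X PUnit.{u + 1}⟩⟩
  iso {M N} _ _ _ _ e := by
    rintro ⟨_, hM⟩
    have := Module.Finite.equiv e
    exact ⟨this, h.iso (FGModuleCat.of R M) (FGModuleCat.of R N) hM ⟨e⟩⟩
  extension {L M N} _ _ _ _ _ _ f g hf hfg hg := by
    rintro ⟨_, hL⟩ ⟨_, hN⟩
    have : Module.Finite R M := Module.Finite.of_exact hfg hg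
    exact ⟨this, h.extension (FGModuleCat.of R L) (FGModuleCat.of R M) (FGModuleCat.of R N)
      f g hf hfg hg hL hN⟩

theorem IsExtensionClosed.ofSet_fst {𝒳 : Set (FGModuleCat.{u} R)}
    (h : IsExtensionClosed R 𝒳) {M N : Type u} [AddCommGroup M] [Module R M] [AddCommGroup N]
    [Module R N] (hMN : ModuleClass.ofSet 𝒳 (M × N)) : ModuleClass.ofSet 𝒳 M := by
  obtain ⟨_, hMN⟩ := hMN
  have := Module.Finite.of_surjective (LinearMap.fst R M N) LinearMap.fst_surjective
  have := Module.Finite.of_surjective (LinearMap.snd R M N) LinearMap.snd_surjective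
  exact ⟨‹_›, h.summand _ (FGModuleCat.of R M) (FGModuleCat.of R N) hMN ⟨LinearEquiv.refl R _⟩⟩

theorem IsExtensionClosed.isSummandStable {𝒳 : Set (FGModuleCat.{u} R)}
    (h : IsExtensionClosed R 𝒳) (hR : ModuleClass.ofSet 𝒳 R) :
    (ModuleClass.ofSet 𝒳).IsSummandStable where
  toIsExtensionStable := h.isExtensionStable hR.2
  finite h := h.1
  summand := h.ofSet_fst
  self := hR

theorem subset_extClosure (𝒳 : Set (FGModuleCat.{u} R)) : 𝒳 ⊆ extClosure R 𝒳 :=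
  fun _ hX _ h => h.2 hX

variable [IsLocalRing R]

theorem MinimalFreeResolution.exists_exact_syzygy {M : Type u} [AddCommGroup M] [Module R M]
    [Module.Finite R M] (F : MinimalFreeResolution R M) (n : ℕ) :
    ∃ (f : F.syzygy (n + 1) →ₗ[R] (Fin (F.β n) → R)) (g : (Fin (F.β n) → R) →ₗ[R] F.syzygy n),
      Function.Injective f ∧ Function.Exact f g ∧ Function.Surjective g := by
  cases n with
  | zero =>
    have hex : Function.Exact (LinearMap.range (F.d 0)).subtype F.ε := LinearMap.exact_iff.2 (by
      rw [Submodule.range_subtype, F.exact_zero.linearMap_ker_eq])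
    exact ⟨(LinearMap.range (F.d 0)).subtype, F.ε, Submodule.subtype_injective _, hex,
      F.ε_surjective⟩
  | succ n =>
    have hex : Function.Exact (LinearMap.range (F.d (n + 1))).subtype (F.d n).rangeRestrict :=
      LinearMap.exact_iff.2 (by
        rw [Submodule.range_subtype, LinearMap.ker_rangeRestrict,
          (F.exact_succ n).linearMap_ker_eq])
    exact ⟨(LinearMap.range (F.d (n + 1))).subtype, (F.d n).rangeRestrict,
      Submodule.subtype_injective _, hex, (F.d n).surjective_rangeRestrict⟩

theorem MinimalFreeResolution.iterCosyzygy_syzygy {P : ModuleClass R} (hP : P.IsExtensionStable)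
    {M : Type u} [AddCommGroup M] [Module R M] [Module.Finite R M]
    (F : MinimalFreeResolution R M) (n : ℕ) (h : P (F.syzygy n)) : P.iterCosyzygy n M := by
  suffices key : ∀ i j, i + j = n → P.iterCosyzygy i (F.syzygy j) from key n 0 (add_zero n)
  intro i
  induction i with
  | zero =>
    rintro j rfl
    rwa [zero_add] at h
  | succ i ih =>
    intro j hj
    obtain ⟨f, g, hf, hfg, hg⟩ := F.exists_exact_syzygy j
    exact (hP.iterCosyzygy i).cosyzygy_of_exact hf hfg hg (ih (j + 1) (by omega))

theorem MinimalFreeResolution.depthGE_syzygy [IsNoetherianRing R] {d : ℕ} (hR : DepthGE R d R)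
    {M : Type u} [AddCommGroup M] [Module R M] [Module.Finite R M]
    (F : MinimalFreeResolution R M) {n : ℕ} (hn : n ≤ d) : DepthGE R n (F.syzygy n) := by
  have hfree (m : ℕ) : DepthGE R d (Fin m → R) := by
    obtain ⟨rs, hl, hm, hrs⟩ := hR
    exact ⟨rs, hl, hm, isWeaklyRegular_of_projective hrs⟩
  induction n with
  | zero => exact ⟨[], rfl, by simp, .nil R _⟩
  | succ n ih =>
    obtain ⟨f, g, hf, hfg, hg⟩ := F.exists_exact_syzygy n
    exact DepthGE.left_of_exact hf hfg hg ((hfree _).mono hn) (ih (by omega))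

variable [IsNoetherianRing R]

theorem isExtensionClosed_CM {d : ℕ} (hd : ringKrullDim R = d) : IsExtensionClosed R (CM R) where
  iso M N hM := fun ⟨e⟩ => by
    rw [mem_CM_iff hd] at *
    exact hM.of_linearEquiv e
  summand M N N' hM := fun ⟨e⟩ => by
    rw [mem_CM_iff hd] at *
    exact (hM.of_linearEquiv e).fst
  extension L M N f g hf hfg hg hL hN := by
    rw [mem_CM_iff hd] at *
    exact hL.of_exact hf hfg hg hN

/-- The d-th syzygy first forces R ∈ 𝒳; only then is the class summand-stable and the reduction
along a regular sequence available. -/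
theorem mem_of_isFreeOnPuncturedSpectrum {d t : ℕ} (hd : ringKrullDim R = d) (hR : DepthGE R d R)
    (ht : t ≤ d) (F : MinimalFreeResolution R (ResidueField R)) {𝒳 : Set (FGModuleCat.{u} R)}
    (h𝒳 : IsExtensionClosed R 𝒳) (hF : ∀ i, t ≤ i → i ≤ d → F.syzygy i ∈ 𝒳)
    {M : FGModuleCat.{u} R} (hM : DepthGE R t M) (hfree : IsFreeOnPuncturedSpectrum R M) :
    M ∈ 𝒳 := by
  have hs := h𝒳.isExtensionStable (hF d ht le_rfl)
  have hk (i : ℕ) (h1 : t ≤ i) (h2 : i ≤ d) :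
      (ModuleClass.ofSet 𝒳).iterCosyzygy i (ResidueField R) :=
    F.iterCosyzygy_syzygy hs i ⟨inferInstance, hF i h1 h2⟩
  have hself := hs.self_of_residueField h𝒳.ofSet_fst hd hR (hk d ht le_rfl)
  exact ((h𝒳.isSummandStable hself).of_isFreeOnPuncturedSpectrum hd hR ht hk hM hfree).2

end ExtensionClosure

theorem theorem1p4 {R : Type u} [CommRing R] [IsLocalRing R] [IsNoetherianRing R]
    (hR : IsCohenMacaulayLocalRing R) (d : ℕ) (hd : ringKrullDim R = d)
    (F : MinimalFreeResolution R (ResidueField R)) :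
    (∀ (M : FGModuleCat.{u} R) (t : ℕ), moduleDepth R M = t → IsFreeOnPuncturedSpectrum R M →
      M ∈ extClosure R {FGModuleCat.of R (⨁ i : Finset.Icc t d, F.syzygy i)}) ∧
    (∀ M ∈ CM R, IsFreeOnPuncturedSpectrum R M →
      M ∈ extClosure R {F.syzygy d}) ∧
    (HasIsolatedSingularity R → CM R = extClosure R {F.syzygy d}) := by
  have hRd : DepthGE R d R := by
    rw [← le_moduleDepth_iff]
    rw [IsCohenMacaulayLocalRing, hd] at hR
    exact le_of_eq (by exact_mod_cast hR.symm)
  have hCM : ∀ M ∈ CM R, IsFreeOnPuncturedSpectrum R M → M ∈ extClosure R {F.syzygy d} := by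
    intro M hM hfree
    refine mem_of_isFreeOnPuncturedSpectrum hd hRd le_rfl F (isExtensionClosed_extClosure R _)
      (fun i h1 h2 => ?_) ((mem_CM_iff hd M).1 hM) hfree
    obtain rfl := le_antisymm h1 h2
    exact subset_extClosure _ rfl
  refine ⟨fun M t hM hfree => ?_, hCM, fun hiso => Set.Subset.antisymm (fun M hM =>
    hCM M hM (hiso.isFreeOnPuncturedSpectrum hd ((mem_CM_iff hd M).1 hM))) fun M hM =>
      hM _ ⟨isExtensionClosed_CM hd, Set.singleton_subset_iff.2
        ((mem_CM_iff hd _).2 (F.depthGE_syzygy hRd le_rfl))⟩⟩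
  have hMt : DepthGE R t M := le_moduleDepth_iff.1 hM.ge
  -- The zero module has infinite depth, so a finite t excludes it.
  have hne : Nontrivial M := by
    by_contra hns
    rw [not_nontrivial_iff_subsingleton] at hns
    have : DepthGE R (t + 1) M :=
      (depthGE_iff_ext _ _).2 fun i _ => subsingleton_ext_of_subsingleton _ _ i
    rw [← le_moduleDepth_iff, hM] at this
    have : t + 1 ≤ t := by exact_mod_cast this
    omega
  have ht : t ≤ d := hMt.le_of_nontrivial hd
  have hX := isExtensionClosed_extClosure R
    {FGModuleCat.of R (⨁ i : Finset.Icc t d, F.syzygy i)}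
  refine mem_of_isFreeOnPuncturedSpectrum hd hRd ht F hX (fun i h1 h2 => ?_) hMt hfree
  let j : Finset.Icc t d := ⟨i, Finset.mem_Icc.2 ⟨h1, h2⟩⟩
  have hmem : ModuleClass.ofSet (extClosure R
      {FGModuleCat.of R (⨁ i : Finset.Icc t d, F.syzygy i)}) (⨁ i : Finset.Icc t d, F.syzygy i) :=
    ⟨inferInstance, subset_extClosure _ (Set.mem_singleton _)⟩
  -- Each syzygy is a summand of the direct sum, hence lies in its extension closure.
  obtain ⟨e⟩ := ModuleClass.nonempty_linearEquiv_prod_of_retract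
    (i := DirectSum.lof R (Finset.Icc t d) (fun i => F.syzygy i) j)
    (p := DirectSum.component R (Finset.Icc t d) (fun i => F.syzygy i) j)
    (fun y => DirectSum.component.lof_self R (M := fun i : Finset.Icc t d => F.syzygy i) j y)
  exact (hX.ofSet_fst ((hX.isExtensionStable hmem.2).iso e hmem)).2
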